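/- Let $k$ be a field and let $n\ge 3$. Let $C_n$ be the cycle on the vertices $x_1,\dots,x_n$, and let $W_n$ be the wheel graph on $n+1$ vertices, that is, $C_n$ together with one additional vertex $x_0$ that is adjacent to every vertex of $C_n$. Denote by the same letters the graph algebras $$C_n=k[x_1,\dots,x_n]/(x_1x_2,\,x_2x_3,\dots,x_{n-1}x_n,\,x_nx_1),$$ $$W_n=k[x_0,\dots,x_n]/(x_1x_2,\,x_2x_3,\dots,x_{n-1}x_n,\,x_nx_1,\,x_0x_1,\dots,x_0x_n).$$ For such an algebra $R=S/I$ ($S$ the polynomial ring in the vertices, with the standard grading) let $\beta_{i,j}(R)$ be its graded Betti numbers over $S$: $\beta_{i,j}(R)$ is the number of basis elements of degree $j$ in the $i$-th free module of the minimal graded free resolution of $R$ over $S$. Put $\beta_{i,j}(R)=0$ for $i<0$. Then: (i) for all integers $i\ge 0$ and $j>i+1$, $$\beta_{i,j}(W_n)=\beta_{i,j}(C_n)+\beta_{i-1,j-1}(C_n);$$ (ii) for all integers $i\ge 1$, $$\beta_{i,i+1}(W_n)=\beta_{i,i+1}(C_n)+\beta_{i-1,i}(C_n)+\binom{n}{i}.$$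 -/

import Mathlib

open MvPolynomial

/-- The edge ideal of a graph `G` on the vertex set `V`: the ideal of the polynomial ring `k[V]`
generated by the products `x_u x_v` over all edges `{u, v}` of `G`. -/
noncomputable def edgeIdeal (k : Type*) [Field k] {V : Type*} (G : SimpleGraph V) :
    Ideal (MvPolynomial V k) :=
  Ideal.span {p | ∃ u v : V, G.Adj u v ∧ p = X u * X v}

/-- The wheel graph: the cycle on the rim vertices `some 0, …, some (n - 1)` together with a
centre `none`, which is adjacent to all rim vertices. -/
def wheelGraph (n : ℕ) : SimpleGraph (Option (Fin n)) where
  Adj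
    | none, none => False
    | none, some _ => True
    | some _, none => True
    | some u, some v => (SimpleGraph.cycleGraph n).Adj u v
  symm := ⟨by
    rintro (_ | u) (_ | v) h
    · exact h
    · trivial
    · trivial
    · exact (SimpleGraph.cycleGraph n).adj_symm h⟩
  loopless := ⟨by
    rintro (_ | u) h
    · exact h
    · exact (SimpleGraph.cycleGraph n).loopless.irrefl u h⟩

/-- Let `deg a` be the degree of the basis element `e_a` of the graded free module
`⨁_a k[σ](-deg a)`. The element `v = ∑ v_a e_a` is homogeneous of degree `m` if every monomial
`x^s e_a` that occurs in it has degree `|s| + deg a = m`. -/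
def IsHomogeneousVec {σ k : Type*} [Field k] {r : ℕ} (deg : Fin r → ℕ) (m : ℕ)
    (v : Fin r → MvPolynomial σ k) : Prop :=
  ∀ a s, coeff s (v a) ≠ 0 → s.degree + deg a = m

/-- A minimal graded free resolution
`⋯ → F_2 → F_1 → F_0 → S/I → 0` of `S/I` over the polynomial ring `S = k[σ]`, where
`F_i = ⨁_a S(-deg i a)` is free of finite rank. -/
structure MinimalGradedFreeResolution {σ k : Type*} [Field k]
    (I : Ideal (MvPolynomial σ k)) where
  /-- the rank of `F_i` -/
  rank : ℕ → ℕ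
  /-- the degrees of the basis elements of `F_i` -/
  deg : (i : ℕ) → Fin (rank i) → ℕ
  /-- the differential `F_{i+1} → F_i` -/
  d : (i : ℕ) → (Fin (rank (i + 1)) → MvPolynomial σ k) →ₗ[MvPolynomial σ k]
    (Fin (rank i) → MvPolynomial σ k)
  /-- the augmentation `F_0 → S/I` -/
  aug : (Fin (rank 0) → MvPolynomial σ k) →ₗ[MvPolynomial σ k] (MvPolynomial σ k ⧸ I)
  /-- the differentials are homogeneous of degree `0` -/
  d_homogeneous : ∀ i a, IsHomogeneousVec (deg i) (deg (i + 1) a) (d i (Pi.single a 1))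
  /-- the augmentation is homogeneous of degree `0` -/
  aug_homogeneous : ∀ a, ∃ p : MvPolynomial σ k, p.IsHomogeneous (deg 0 a) ∧
    aug (Pi.single a 1) = Ideal.Quotient.mk I p
  aug_surjective : Function.Surjective aug
  exact_zero : Function.Exact (d 0) aug
  exact_succ : ∀ i, Function.Exact (d (i + 1)) (d i)
  /-- minimality: `d F_{i+1}` is contained in `𝔪 F_i`, where `𝔪` is generated by the variables -/
  minimal : ∀ i a b, constantCoeff (d i (Pi.single a 1) b) = 0

/-- The number of basis elements of degree `j` of the `i`-th module of the resolution. -/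
def MinimalGradedFreeResolution.betti {σ k : Type*} [Field k] {I : Ideal (MvPolynomial σ k)}
    (F : MinimalGradedFreeResolution I) (i j : ℕ) : ℕ :=
  (Finset.univ.filter fun a : Fin (F.rank i) => F.deg i a = j).card

section Existence

variable {σ k : Type*} [Field k]

/-- The component of degree `j` of an element of the graded free module. -/
noncomputable def vecComponent {r : ℕ} (deg : Fin r → ℕ) (j : ℕ)
    (v : Fin r → MvPolynomial σ k) : Fin r → MvPolynomial σ k :=
  fun a => if deg a ≤ j then homogeneousComponent (j - deg a) (v a) else 0

theorem coeff_vecComponent {r : ℕ} (deg : Fin r → ℕ) (j : ℕ)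
    (v : Fin r → MvPolynomial σ k) (a : Fin r) (s : σ →₀ ℕ) :
    coeff s (vecComponent deg j v a) = if s.degree + deg a = j then coeff s (v a) else 0 := by
  unfold vecComponent
  by_cases h : deg a ≤ j
  · rw [if_pos h, coeff_homogeneousComponent]
    by_cases h2 : s.degree + deg a = j
    · rw [if_pos h2, if_pos (by omega)]
    · rw [if_neg h2, if_neg (by omega)]
  · rw [if_neg h, if_neg (by omega), coeff_zero]

theorem vecComponent_homogeneous {r : ℕ} (deg : Fin r → ℕ) (j : ℕ)
    (v : Fin r → MvPolynomial σ k) : IsHomogeneousVec deg j (vecComponent deg j v) := by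
  intro a s h
  rw [coeff_vecComponent] at h
  by_contra h2
  exact h (if_neg h2)

theorem sum_vecComponent {r : ℕ} (deg : Fin r → ℕ) (v : Fin r → MvPolynomial σ k) :
    ∃ B, ∑ j ∈ Finset.range B, vecComponent deg j v = v := by
  refine ⟨∑ a, ((v a).totalDegree + deg a + 1), ?_⟩
  funext a
  ext s
  rw [Finset.sum_apply, coeff_sum]
  simp only [coeff_vecComponent]
  rw [Finset.sum_ite_eq]
  split_ifs with h
  · rfl
  · by_contra h2
    apply h
    have h3 : s.degree ≤ (v a).totalDegree := by
      have := le_totalDegree (mem_support_iff.mpr (Ne.symm h2))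
      exact this
    have h4 := Finset.single_le_sum (f := fun a => (v a).totalDegree + deg a + 1)
      (fun _ _ => Nat.zero_le _) (Finset.mem_univ a)
    rw [Finset.mem_range]
    have h5 : (v a).totalDegree + deg a + 1 ≤ ∑ a, ((v a).totalDegree + deg a + 1) := h4
    omega

theorem vecComponent_smul {r : ℕ} (deg : Fin r → ℕ) (j m : ℕ)
    (p : MvPolynomial σ k) (v : Fin r → MvPolynomial σ k) (hv : IsHomogeneousVec deg m v) :
    vecComponent deg j (p • v) =
      (if m ≤ j then homogeneousComponent (j - m) p else 0) • v := by
  classical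
  funext a
  ext s
  have key : ∀ q : MvPolynomial σ k, coeff s (q * v a) =
      ∑ x ∈ Finset.HasAntidiagonal.antidiagonal s, coeff x.1 q * coeff x.2 (v a) := fun q => coeff_mul _ _ _
  rw [coeff_vecComponent]
  simp only [Pi.smul_apply, smul_eq_mul]
  rw [key, key]
  have push : ∀ (P : Prop) [Decidable P] (f : (σ →₀ ℕ) × (σ →₀ ℕ) → k) (t : Finset _),
      (if P then ∑ x ∈ t, f x else 0) = ∑ x ∈ t, if P then f x else 0 := by
    intro P _ f t
    split_ifs <;> simp
  rw [push]
  refine Finset.sum_congr rfl fun x hx => ?_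
  rw [Finset.HasAntidiagonal.mem_antidiagonal] at hx
  have hd : s.degree = x.1.degree + x.2.degree := by rw [← hx, map_add]
  by_cases h : coeff x.2 (v a) = 0
  · simp [h]
  · have := hv a _ h
    by_cases h2 : m ≤ j
    · rw [if_pos h2, coeff_homogeneousComponent]
      by_cases h3 : s.degree + deg a = j
      · rw [if_pos h3, if_pos (by omega)]
      · rw [if_neg h3, if_neg (by omega), zero_mul]
    · rw [if_neg h2, if_neg (by omega), coeff_zero, zero_mul]

theorem vecComponent_sum {r : ℕ} (deg : Fin r → ℕ) (j : ℕ) {ι : Type*} (t : Finset ι)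
    (f : ι → Fin r → MvPolynomial σ k) :
    vecComponent deg j (∑ i ∈ t, f i) = ∑ i ∈ t, vecComponent deg j (f i) := by
  funext a
  ext s
  simp only [Finset.sum_apply, coeff_sum, coeff_vecComponent]
  split_ifs
  · rfl
  · simp

theorem vecComponent_linearCombination {r s : ℕ} (deg : Fin r → ℕ) (deg' : Fin s → ℕ)
    (g : Fin s → Fin r → MvPolynomial σ k) (hg : ∀ a, IsHomogeneousVec deg (deg' a) (g a))
    (j : ℕ) (c : Fin s → MvPolynomial σ k) :
    vecComponent deg j (∑ a, c a • g a) = ∑ a, vecComponent deg' j c a • g a := by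
  rw [vecComponent_sum]
  exact Finset.sum_congr rfl fun a _ => vecComponent_smul deg j _ _ _ (hg a)

/-- A submodule that contains the homogeneous components of its elements. -/
def IsGradedSubmodule {r : ℕ} (deg : Fin r → ℕ)
    (N : Submodule (MvPolynomial σ k) (Fin r → MvPolynomial σ k)) : Prop :=
  ∀ v ∈ N, ∀ j, vecComponent deg j v ∈ N

theorem exists_homogeneous_generators [Finite σ] {r : ℕ} (deg : Fin r → ℕ)
    (N : Submodule (MvPolynomial σ k) (Fin r → MvPolynomial σ k))
    (hN : IsGradedSubmodule deg N) :
    ∃ (s : ℕ) (deg' : Fin s → ℕ) (g : Fin s → Fin r → MvPolynomial σ k),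
      (∀ a, IsHomogeneousVec deg (deg' a) (g a)) ∧
        Submodule.span (MvPolynomial σ k) (Set.range g) = N := by
  classical
  obtain ⟨T, hT⟩ : N.FG := IsNoetherian.noetherian N
  choose B hB using fun v : Fin r → MvPolynomial σ k => sum_vecComponent deg v
  let J := Σ v : T, Fin (B v)
  let e := (Fintype.equivFin J).symm
  refine ⟨Fintype.card J, fun a => (e a).2, fun a => vecComponent deg (e a).2 (e a).1, fun a =>
    vecComponent_homogeneous _ _ _, le_antisymm ?_ ?_⟩
  · rw [Submodule.span_le]
    rintro _ ⟨a, rfl⟩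
    exact hN _ (hT ▸ Submodule.subset_span (e a).1.2) _
  · rw [← hT, Submodule.span_le]
    intro v hv
    rw [← hB v]
    refine Submodule.sum_mem _ fun j hj => Submodule.subset_span ?_
    rw [Finset.mem_range] at hj
    have hall : ∀ x : J, vecComponent deg x.2 (x.1 : Fin r → MvPolynomial σ k) ∈
        Set.range fun a => vecComponent deg (e a).2 (e a).1 := by
      intro x
      obtain ⟨a, rfl⟩ := e.surjective x
      exact ⟨a, rfl⟩
    exact hall ⟨⟨v, hv⟩, ⟨j, hj⟩⟩

theorem exists_minimal_generators [Finite σ] {r : ℕ} (deg : Fin r → ℕ)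
    (N : Submodule (MvPolynomial σ k) (Fin r → MvPolynomial σ k))
    (hN : IsGradedSubmodule deg N) :
    ∃ (s : ℕ) (deg' : Fin s → ℕ) (g : Fin s → Fin r → MvPolynomial σ k),
      (∀ a, IsHomogeneousVec deg (deg' a) (g a)) ∧
        Submodule.span (MvPolynomial σ k) (Set.range g) = N ∧
        ∀ c : Fin s → MvPolynomial σ k, ∑ a, c a • g a = 0 → ∀ a, constantCoeff (c a) = 0 := by
  classical
  have hex := exists_homogeneous_generators deg N hN
  obtain ⟨deg', g, hg, hspan⟩ := Nat.find_spec hex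
  refine ⟨Nat.find hex, deg', g, hg, hspan, ?_⟩
  have hmin := fun m (hm : m < Nat.find hex) => Nat.find_min hex hm
  generalize Nat.find hex = s at *
  intro c hc b
  by_contra hb
  cases s with
  | zero => exact b.elim0
  | succ s =>
    apply hmin s (Nat.lt_succ_self s)
    refine ⟨fun a => deg' (b.succAbove a), fun a => g (b.succAbove a), fun a => hg _, ?_⟩
    have h1 := vecComponent_linearCombination deg deg' g hg (deg' b) c
    rw [hc] at h1
    have h0 : vecComponent deg (deg' b) (0 : Fin r → MvPolynomial σ k) = 0 := by
      funext a; ext x; simp [coeff_vecComponent]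
    rw [h0, Fin.sum_univ_succAbove _ b] at h1
    have h2 : vecComponent deg' (deg' b) c b = C (constantCoeff (c b)) := by
      simp [vecComponent, homogeneousComponent_zero, constantCoeff_eq]
    rw [h2] at h1
    have h3 : g b ∈ Submodule.span (MvPolynomial σ k)
        (Set.range fun a => g (b.succAbove a)) := by
      have h4 : g b = (C (constantCoeff (c b))⁻¹ : MvPolynomial σ k) •
          (C (constantCoeff (c b)) : MvPolynomial σ k) • g b := by
        rw [smul_smul, ← C_mul, inv_mul_cancel₀ hb, C_1, one_smul]
      rw [h4]
      refine Submodule.smul_mem _ _ ?_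
      rw [eq_neg_of_add_eq_zero_left h1.symm]
      refine Submodule.neg_mem _ (Submodule.sum_mem _ fun a _ => Submodule.smul_mem _ _ ?_)
      exact Submodule.subset_span ⟨a, rfl⟩
    refine le_antisymm ?_ ?_
    · rw [← hspan]
      apply Submodule.span_mono
      rintro _ ⟨a, rfl⟩
      exact ⟨_, rfl⟩
    · rw [← hspan, Submodule.span_le]
      rintro _ ⟨a, rfl⟩
      rcases Fin.eq_self_or_eq_succAbove b a with h | ⟨a', h⟩
      · rw [h]; exact h3
      · rw [h]; exact Submodule.subset_span ⟨a', rfl⟩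

/-- A graded submodule of a graded free module. -/
structure GradedSyzygy (σ k : Type*) [Field k] where
  rank : ℕ
  deg : Fin rank → ℕ
  N : Submodule (MvPolynomial σ k) (Fin rank → MvPolynomial σ k)
  graded : IsGradedSubmodule deg N

theorem GradedSyzygy.exists_cover [Finite σ] (A : GradedSyzygy σ k) :
    ∃ (B : GradedSyzygy σ k) (f : (Fin B.rank → MvPolynomial σ k) →ₗ[MvPolynomial σ k]
        (Fin A.rank → MvPolynomial σ k)),
      (∀ a, IsHomogeneousVec A.deg (B.deg a) (f (Pi.single a 1))) ∧
        LinearMap.range f = A.N ∧ B.N = LinearMap.ker f ∧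
        ∀ c ∈ B.N, ∀ a, constantCoeff (c a) = 0 := by
  classical
  obtain ⟨s, deg', g, hg, hspan, hmin⟩ := exists_minimal_generators A.deg A.N A.graded
  refine ⟨⟨s, deg', LinearMap.ker (Fintype.linearCombination (MvPolynomial σ k) g), ?_⟩,
    Fintype.linearCombination (MvPolynomial σ k) g, ?_, ?_, rfl, ?_⟩
  · intro c hc j
    rw [LinearMap.mem_ker, Fintype.linearCombination_apply] at hc ⊢
    rw [← vecComponent_linearCombination A.deg deg' g hg, hc]
    funext a; ext x; simp [coeff_vecComponent]
  · intro a
    have : Fintype.linearCombination (MvPolynomial σ k) g (Pi.single a 1) = g a := by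
      simp
    rw [this]
    exact hg a
  · rw [Fintype.range_linearCombination, hspan]
  · intro c hc
    exact hmin c hc

/-- The successive modules of syzygies in a minimal graded free resolution. -/
noncomputable def GradedSyzygy.iter [Finite σ] (A : GradedSyzygy σ k) : ℕ → GradedSyzygy σ k
  | 0 => A
  | i + 1 => (A.iter i).exists_cover.choose

theorem GradedSyzygy.exists_tower [Finite σ] (A : GradedSyzygy σ k) :
    ∃ (B : ℕ → GradedSyzygy σ k)
      (f : (i : ℕ) → (Fin (B (i + 1)).rank → MvPolynomial σ k) →ₗ[MvPolynomial σ k]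
        (Fin (B i).rank → MvPolynomial σ k)), B 0 = A ∧ ∀ i,
      (∀ a, IsHomogeneousVec (B i).deg ((B (i + 1)).deg a) (f i (Pi.single a 1))) ∧
        LinearMap.range (f i) = (B i).N ∧ (B (i + 1)).N = LinearMap.ker (f i) ∧
        ∀ c ∈ (B (i + 1)).N, ∀ a, constantCoeff (c a) = 0 :=
  ⟨A.iter, fun i => (A.iter i).exists_cover.choose_spec.choose, rfl,
    fun i => (A.iter i).exists_cover.choose_spec.choose_spec⟩

theorem exists_minimalGradedFreeResolution [Finite σ] (I : Ideal (MvPolynomial σ k))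
    (hI : ∀ p ∈ I, ∀ j, homogeneousComponent j p ∈ I) (hI' : ∀ p ∈ I, constantCoeff p = 0) :
    Nonempty (MinimalGradedFreeResolution I) := by
  classical
  let A : GradedSyzygy σ k := ⟨1, fun _ => 0, Submodule.comap (LinearMap.proj 0) I, by
    intro v hv j
    simpa [vecComponent] using hI _ hv j⟩
  obtain ⟨B, f, hB0, hB⟩ := A.exists_tower
  have haug : ∀ A', A' = A → ∃ aug : (Fin A'.rank → MvPolynomial σ k) →ₗ[MvPolynomial σ k]
      (MvPolynomial σ k ⧸ I), (∀ a, ∃ p : MvPolynomial σ k, p.IsHomogeneous (A'.deg a) ∧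
        aug (Pi.single a 1) = Ideal.Quotient.mk I p) ∧ Function.Surjective aug ∧
        LinearMap.ker aug = A'.N ∧ ∀ v ∈ A'.N, ∀ a, constantCoeff (v a) = 0 := by
    rintro _ rfl
    refine ⟨(Submodule.mkQ I).comp (LinearMap.proj (0 : Fin 1)), ?_, ?_, ?_, ?_⟩
    · intro a
      refine ⟨1, isHomogeneous_one σ k, ?_⟩
      have ha : a = (0 : Fin 1) := Subsingleton.elim (α := Fin 1) a 0
      rw [ha]
      change Submodule.mkQ I ((Pi.single (0 : Fin 1) (1 : MvPolynomial σ k) : Fin 1 → _) 0) = _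
      rw [Pi.single_eq_same]
      rfl
    · intro y
      obtain ⟨p, rfl⟩ := Submodule.mkQ_surjective I y
      exact ⟨fun _ => p, rfl⟩
    · rw [LinearMap.ker_comp, Submodule.ker_mkQ]
    · intro v hv b
      have hb : b = (0 : Fin 1) := Subsingleton.elim (α := Fin 1) b 0
      rw [hb]
      exact hI' _ hv
  obtain ⟨aug, h1, h2, h3, h4⟩ := haug (B 0) hB0
  refine ⟨{
    rank := fun i => (B i).rank
    deg := fun i => (B i).deg
    d := f
    aug := aug
    d_homogeneous := fun i => (hB i).1
    aug_homogeneous := h1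
    aug_surjective := h2
    exact_zero := LinearMap.exact_iff.mpr (h3.trans (hB 0).2.1.symm)
    exact_succ := fun i =>
      LinearMap.exact_iff.mpr ((hB i).2.2.1.symm.trans (hB (i + 1)).2.1.symm)
    minimal := ?_ }⟩
  intro i a b
  have h5 : f i (Pi.single a 1) ∈ (B i).N := (hB i).2.1 ▸ LinearMap.mem_range_self _ _
  cases i with
  | zero => exact h4 _ h5 b
  | succ i => exact (hB i).2.2.2 _ h5 b

end Existence

theorem exists_minimalGradedFreeResolution_edgeIdeal (k : Type*) [Field k] {V : Type*} [Finite V]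
    (G : SimpleGraph V) : Nonempty (MinimalGradedFreeResolution (edgeIdeal k G)) := by
  apply exists_minimalGradedFreeResolution
  · intro p hp j
    let _ : GradedAlgebra (homogeneousSubmodule V k) := MvPolynomial.gradedAlgebra
    have h : (edgeIdeal k G).IsHomogeneous (homogeneousSubmodule V k) := by
      apply Ideal.homogeneous_span
      rintro _ ⟨u, v, -, rfl⟩
      exact ⟨2, (isHomogeneous_X k u).mul (isHomogeneous_X k v)⟩
    exact homogeneousComponent_mem_of_mem h hp j
  · have h : edgeIdeal k G ≤ RingHom.ker (constantCoeff : MvPolynomial V k →+* k) := by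
      rw [edgeIdeal, Ideal.span_le]
      rintro _ ⟨u, v, -, rfl⟩
      simp [RingHom.mem_ker]
    exact fun p hp => h hp

/-- The graded Betti number `β_{i,j}` of the graph algebra of `G` over `k`: the number of basis
elements of degree `j` of `F_i` in a minimal graded free resolution `F` of the graph algebra over
the polynomial ring in the vertices of `G`. Such a resolution exists and is unique up to
isomorphism, so that it does not matter which one is taken. -/
noncomputable def gradedBetti (k : Type*) [Field k] {V : Type*} [Finite V] (G : SimpleGraph V)
    (i j : ℕ) : ℕ :=
  (exists_minimalGradedFreeResolution_edgeIdeal k G).some.betti i j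

/-! Write `A` for the edge ideal of the cycle, extended to the polynomial ring with the extra
variable `x₀`, and `B = (x₁, …, xₙ)`. The edge ideal of the wheel is `A + x₀B`
(`edgeIdeal_wheelGraph`). Here `A ⊆ B`, and `x₀` is a nonzerodivisor modulo `A`, so `A ∩ x₀B = x₀A`.
This gives an exact sequence `0 → A(-1) → A ⊕ B(-1) → A + x₀B → 0` whose first map is `a ↦ (x₀a,
-a)`.

Let `F` be a minimal resolution of `A`, `K` the Koszul resolution of `B`, and `φ : F → K` a lift of
the inclusion. The mapping cone of `(x₀, -φ) : F(-1) → F ⊕ K(-1)` resolves `A + x₀B`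
(`exists_cone`). It is minimal: `K_i` is generated in degree `i + 1` and `F_i` in degrees at least
`i + 2` (`IsMinimal.add_two_le_deg`), so the homogeneous map `φ` has no nonzero constant entries.
Counting the generators of the cone gives the formulas: `F` contributes the Betti numbers of the
cycle, `F(-1)` the shifted ones, and `K(-1)` the binomial coefficient, on the linear strand only.

Betti numbers are defined by a chosen resolution, so the count also needs uniqueness
(`IsMinimal.count_eq`): a graded endomorphism of a minimal resolution that lifts the identity is the
identity modulo the variables. Finally, a minimal resolution of `S/I` becomes one of `I` when `F₀ =
S` is dropped (`exists_idealResolution`), which shifts the homological index by one. -/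

open scoped Matrix

/-! ### Homogeneous matrices and exactness -/

section GradedMatrices

variable {σ k : Type*} [Field k] {α β γ : Type*}

/-- The matrix `M` describes a homogeneous map of degree `0` from the graded free module with
basis degrees `degβ` to the one with basis degrees `degα`. -/
def IsHomogeneousMatrix (degα : α → ℕ) (degβ : β → ℕ) (M : Matrix α β (MvPolynomial σ k)) : Prop :=
  ∀ a b s, coeff s (M a b) ≠ 0 → s.degree + degα a = degβ b

/-- The sequence of free modules described by the matrices `D` and `E` is exact. -/
def IsExactPair {R : Type*} [CommRing R] [Fintype β] [Fintype γ] (D : Matrix α β R)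
    (E : Matrix β γ R) : Prop :=
  ∀ w, D *ᵥ w = 0 ↔ ∃ v, E *ᵥ v = w

theorem IsHomogeneousMatrix.mul [Fintype β] {degα : α → ℕ} {degβ : β → ℕ} {degγ : γ → ℕ}
    {M : Matrix α β (MvPolynomial σ k)} {N : Matrix β γ (MvPolynomial σ k)}
    (hM : IsHomogeneousMatrix degα degβ M) (hN : IsHomogeneousMatrix degβ degγ N) :
    IsHomogeneousMatrix degα degγ (M * N) := by
  classical
  intro a c s h
  rw [Matrix.mul_apply, coeff_sum] at h
  obtain ⟨b, -, hb⟩ := Finset.exists_ne_zero_of_sum_ne_zero h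
  rw [coeff_mul] at hb
  obtain ⟨x, hx, hxb⟩ := Finset.exists_ne_zero_of_sum_ne_zero hb
  rw [Finset.HasAntidiagonal.mem_antidiagonal] at hx
  have h1 := hM a b _ (left_ne_zero_of_mul hxb)
  have h2 := hN b c _ (right_ne_zero_of_mul hxb)
  rw [← hx, map_add]
  omega

theorem IsHomogeneousMatrix.deg_eq {degα : α → ℕ} {degβ : β → ℕ}
    {M : Matrix α β (MvPolynomial σ k)} (hM : IsHomogeneousMatrix degα degβ M) {a : α} {b : β}
    (h : constantCoeff (M a b) ≠ 0) : degα a = degβ b := by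
  have := hM a b 0 (by rwa [constantCoeff_eq] at h)
  simpa using this

/-- When `D` and `M` are homogeneous, the equation `D * N = M` splits by degree, so keeping only the
part of the right degree in each entry of a solution leaves a solution. -/
theorem IsHomogeneousMatrix.exists_mul_eq [Fintype β] {degα : α → ℕ} {degβ : β → ℕ} {degγ : γ → ℕ}
    {D : Matrix α β (MvPolynomial σ k)} {M : Matrix α γ (MvPolynomial σ k)}
    (hD : IsHomogeneousMatrix degα degβ D) (hM : IsHomogeneousMatrix degα degγ M)
    (h : ∃ N : Matrix β γ (MvPolynomial σ k), D * N = M) :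
    ∃ N : Matrix β γ (MvPolynomial σ k), IsHomogeneousMatrix degβ degγ N ∧ D * N = M := by
  classical
  obtain ⟨w, hw⟩ := h
  let N : Matrix β γ (MvPolynomial σ k) := fun b c =>
    if degβ b ≤ degγ c then homogeneousComponent (degγ c - degβ b) (w b c) else 0
  have hN : ∀ b c s, coeff s (N b c) = if s.degree + degβ b = degγ c then coeff s (w b c) else 0 := by
    intro b c s
    change coeff s (if degβ b ≤ degγ c then _ else _) = _
    by_cases h : degβ b ≤ degγ c
    · rw [if_pos h, coeff_homogeneousComponent]
      by_cases h2 : s.degree + degβ b = degγ c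
      · rw [if_pos h2, if_pos (by omega)]
      · rw [if_neg h2, if_neg (by omega)]
    · rw [if_neg h, if_neg (by omega), coeff_zero]
  have hNh : IsHomogeneousMatrix degβ degγ N := by
    intro b c s hs
    rw [hN] at hs
    by_contra h2
    exact hs (if_neg h2)
  refine ⟨N, hNh, ?_⟩
  ext a c s
  by_cases hs : s.degree + degα a = degγ c
  · rw [← hw, Matrix.mul_apply, Matrix.mul_apply, coeff_sum, coeff_sum]
    refine Finset.sum_congr rfl fun b _ => ?_
    rw [coeff_mul, coeff_mul]
    refine Finset.sum_congr rfl fun x hx => ?_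
    rw [Finset.HasAntidiagonal.mem_antidiagonal] at hx
    by_cases h0 : coeff x.1 (D a b) = 0
    · rw [h0, zero_mul, zero_mul]
    · have h1 := hD a b _ h0
      rw [← hx, map_add] at hs
      rw [hN, if_pos (by omega)]
  · have h1 : coeff s (M a c) = 0 := by
      by_contra h0
      exact hs (hM a c s h0)
    have h2 : coeff s ((D * N) a c) = 0 := by
      by_contra h0
      exact hs (hD.mul hNh a c s h0)
    rw [h1, h2]

theorem IsExactPair.exists_mul_eq {R δ : Type*} [CommRing R] [Fintype β] [Fintype γ]
    {D : Matrix α β R} {E : Matrix β γ R} (h : IsExactPair D E) {M : Matrix β δ R}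
    (hM : D * M = 0) : ∃ N : Matrix γ δ R, E * N = M := by
  have : ∀ c, ∃ v, E *ᵥ v = fun b => M b c := by
    intro c
    apply (h _).1
    funext a
    exact congrFun (congrFun hM a) c
  choose v hv using this
  refine ⟨fun g c => v c g, ?_⟩
  ext b c
  exact congrFun (hv c) b

theorem IsExactPair.mul_eq_zero {R : Type*} [CommRing R] [Fintype β] [Fintype γ]
    {D : Matrix α β R} {E : Matrix β γ R} (h : IsExactPair D E) : D * E = 0 := by
  classical
  apply Matrix.ext_of_mulVec_single
  intro i
  rw [← Matrix.mulVec_mulVec, (h _).2 ⟨_, rfl⟩, Matrix.zero_mulVec]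

end GradedMatrices

/-! ### Resolutions of ideals: comparison maps and uniqueness of Betti numbers -/

/-- A graded free resolution `⋯ → F_1 → F_0 → A → 0` of the homogeneous ideal `A` of the
polynomial ring, with differentials given by matrices. -/
structure IdealResolution {σ k : Type*} [Field k] (A : Ideal (MvPolynomial σ k)) where
  /-- the index set of the basis of `F_i` -/
  idx : ℕ → Type
  [fintypeIdx : ∀ i, Fintype (idx i)]
  /-- the degrees of the basis elements of `F_i` -/
  deg : ∀ i, idx i → ℕ
  /-- the map `F_0 → A` -/
  aug : Matrix Unit (idx 0) (MvPolynomial σ k)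
  /-- the differential `F_{i+1} → F_i` -/
  d : ∀ i, Matrix (idx i) (idx (i + 1)) (MvPolynomial σ k)
  aug_homogeneous : IsHomogeneousMatrix (fun _ => 0) (deg 0) aug
  d_homogeneous : ∀ i, IsHomogeneousMatrix (deg i) (deg (i + 1)) (d i)
  mem_iff : ∀ p, p ∈ A ↔ ∃ w, (aug *ᵥ w) () = p
  exact_zero : IsExactPair aug (d 0)
  exact_succ : ∀ i, IsExactPair (d i) (d (i + 1))

attribute [instance] IdealResolution.fintypeIdx

theorem exists_seq_of_step {X : ℕ → Type*} {Q : ∀ i, X i → Prop} {R : ∀ i, X i → X (i + 1) → Prop}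
    (x₀ : X 0) (h₀ : Q 0 x₀) (step : ∀ i x, Q i x → ∃ y, Q (i + 1) y ∧ R i x y) :
    ∃ f : ∀ i, X i, f 0 = x₀ ∧ (∀ i, Q i (f i)) ∧ ∀ i, R i (f i) (f (i + 1)) := by
  choose g hgQ hgR using step
  let F : ∀ i, {x : X i // Q i x} :=
    fun i => Nat.rec ⟨x₀, h₀⟩ (fun i x => ⟨g i x.1 x.2, hgQ i x.1 x.2⟩) i
  exact ⟨fun i => (F i).1, rfl, fun i => (F i).2, fun i => hgR i (F i).1 (F i).2⟩

namespace IdealResolution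

variable {σ k : Type*} [Field k] {A B : Ideal (MvPolynomial σ k)}

/-- Minimality: the entries of the differentials lie in the ideal generated by the variables. -/
def IsMinimal (F : IdealResolution A) : Prop :=
  ∀ i a b, constantCoeff (F.d i a b) = 0

/-- The number of basis elements of degree `j` of `F_i`. -/
def count (F : IdealResolution A) (i j : ℕ) : ℕ :=
  Fintype.card {a : F.idx i // F.deg i a = j}

theorem exists_lift (F : IdealResolution A) (K : IdealResolution B) (hAB : A ≤ B) :
    ∃ φ : ∀ i, Matrix (K.idx i) (F.idx i) (MvPolynomial σ k),
      (∀ i, IsHomogeneousMatrix (K.deg i) (F.deg i) (φ i)) ∧ K.aug * φ 0 = F.aug ∧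
        ∀ i, K.d i * φ (i + 1) = φ i * F.d i := by
  classical
  have h0 : ∃ N : Matrix (K.idx 0) (F.idx 0) (MvPolynomial σ k), K.aug * N = F.aug := by
    have : ∀ c, ∃ v, (K.aug *ᵥ v) () = F.aug () c := by
      intro c
      refine (K.mem_iff _).1 (hAB ((F.mem_iff _).2 ⟨Pi.single c 1, ?_⟩))
      simp
    choose v hv using this
    refine ⟨fun g c => v c g, ?_⟩
    ext b c
    exact congrArg _ (hv c)
  obtain ⟨φ₀, hφ₀, hφ₀'⟩ := K.aug_homogeneous.exists_mul_eq F.aug_homogeneous h0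
  -- The invariant includes solvability of the next lifting equation: this depends on how `φ i`
  -- commutes with the previous differential, which `φ i` alone does not record.
  obtain ⟨φ, h0, hQ, hR⟩ := exists_seq_of_step
    (X := fun i => Matrix (K.idx i) (F.idx i) (MvPolynomial σ k))
    (Q := fun i φ => IsHomogeneousMatrix (K.deg i) (F.deg i) φ ∧
      ∃ N : Matrix (K.idx (i + 1)) (F.idx (i + 1)) (MvPolynomial σ k), K.d i * N = φ * F.d i)
    (R := fun i φ ψ => K.d i * ψ = φ * F.d i) φ₀
    ⟨hφ₀, K.exact_zero.exists_mul_eq (by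
      rw [← Matrix.mul_assoc, hφ₀', F.exact_zero.mul_eq_zero])⟩
    (by
      rintro i φ ⟨hφ, hN⟩
      obtain ⟨ψ, hψ, hψ'⟩ := (K.d_homogeneous i).exists_mul_eq (hφ.mul (F.d_homogeneous i)) hN
      refine ⟨ψ, ⟨hψ, (K.exact_succ i).exists_mul_eq ?_⟩, hψ'⟩
      rw [← Matrix.mul_assoc, hψ', Matrix.mul_assoc, (F.exact_succ i).mul_eq_zero,
        Matrix.mul_zero])
  exact ⟨φ, fun i => (hQ i).1, by rw [h0, hφ₀'], hR⟩

/-- The chain map `u` lifts the zero map, so it is null-homotopic. Both terms of `d h' + h d` have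
entries in the ideal of the variables, because those of `d` do. -/
theorem IsMinimal.constantCoeff_eq_zero {F : IdealResolution A} (hF : F.IsMinimal)
    (u : ∀ i, Matrix (F.idx i) (F.idx i) (MvPolynomial σ k)) (h0 : F.aug * u 0 = 0)
    (hu : ∀ i, F.d i * u (i + 1) = u i * F.d i) (i : ℕ) (a b : F.idx i) :
    constantCoeff (u i a b) = 0 := by
  have hl : ∀ {i : ℕ} {β : Type} (h : Matrix (F.idx (i + 1)) β (MvPolynomial σ k)) a b,
      constantCoeff ((F.d i * h) a b) = 0 := by
    intro i β h a b
    rw [Matrix.mul_apply, map_sum]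
    exact Finset.sum_eq_zero fun c _ => by rw [map_mul, hF, zero_mul]
  have hr : ∀ {i : ℕ} {β : Type} (h : Matrix β (F.idx i) (MvPolynomial σ k)) a b,
      constantCoeff ((h * F.d i) a b) = 0 := by
    intro i β h a b
    rw [Matrix.mul_apply, map_sum]
    exact Finset.sum_eq_zero fun c _ => by rw [map_mul, hF, mul_zero]
  -- The homotopy is built one degree at a time; the first conjunct says that `u (i + 1) - h d`
  -- consists of cycles, which yields the next component.
  have key : ∀ i, ∃ h : Matrix (F.idx (i + 1)) (F.idx i) (MvPolynomial σ k),
      F.d i * (u (i + 1) - h * F.d i) = 0 ∧ ∀ a b, constantCoeff (u i a b) = 0 := by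
    intro i
    induction i with
    | zero =>
      obtain ⟨h, hh⟩ := F.exact_zero.exists_mul_eq h0
      refine ⟨h, ?_, ?_⟩
      · rw [Matrix.mul_sub, hu, ← Matrix.mul_assoc, hh, sub_self]
      · intro a b
        rw [← hh, hl]
    | succ i ih =>
      obtain ⟨h, hh, -⟩ := ih
      obtain ⟨h', hh'⟩ := (F.exact_succ i).exists_mul_eq hh
      refine ⟨h', ?_, ?_⟩
      · rw [Matrix.mul_sub, hu, ← Matrix.mul_assoc, hh', Matrix.sub_mul, Matrix.mul_assoc,
          (F.exact_succ i).mul_eq_zero, Matrix.mul_zero, sub_zero, sub_self]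
      · intro a b
        rw [sub_eq_iff_eq_add'.1 hh'.symm, Matrix.add_apply, map_add, hl, hr, add_zero]
  obtain ⟨-, -, h⟩ := key i
  exact h a b

/-- Comparison maps `f : F → G` and `g : G → F` satisfy `g f ≡ 1` modulo the variables. Hence the
constant part of `f` is injective on the generators of each degree; only `F` has to be minimal. -/
theorem IsMinimal.count_le {F : IdealResolution A} (hF : F.IsMinimal) (G : IdealResolution A)
    (i j : ℕ) : F.count i j ≤ G.count i j := by
  classical
  obtain ⟨f, hf, hf0, hfd⟩ := F.exists_lift G le_rfl
  obtain ⟨g, hg, hg0, hgd⟩ := G.exists_lift F le_rfl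
  have hu := hF.constantCoeff_eq_zero (fun i => g i * f i - 1)
    (by rw [Matrix.mul_sub, ← Matrix.mul_assoc, hg0, hf0, Matrix.mul_one, sub_self])
    (by
      intro i
      rw [Matrix.mul_sub, ← Matrix.mul_assoc, hgd, Matrix.mul_assoc, hfd, Matrix.sub_mul,
        Matrix.mul_assoc, Matrix.mul_one, Matrix.one_mul]) i
  let f' : Matrix {a : G.idx i // G.deg i a = j} {a : F.idx i // F.deg i a = j} k :=
    fun a b => constantCoeff (f i a b)
  let g' : Matrix {a : F.idx i // F.deg i a = j} {a : G.idx i // G.deg i a = j} k :=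
    fun a b => constantCoeff (g i a b)
  have hgf : g' * f' = 1 := by
    ext a b
    have h1 := hu a b
    rw [Matrix.sub_apply, map_sub, sub_eq_zero, Matrix.mul_apply, map_sum] at h1
    rw [Matrix.mul_apply]
    have h2 : ((1 : Matrix {a : F.idx i // F.deg i a = j} {a : F.idx i // F.deg i a = j} k) a b) =
        constantCoeff ((1 : Matrix (F.idx i) (F.idx i) (MvPolynomial σ k)) a b) := by
      by_cases h : a = b
      · rw [h, Matrix.one_apply_eq, Matrix.one_apply_eq, map_one]
      · rw [Matrix.one_apply_ne h, Matrix.one_apply_ne (fun h' => h (Subtype.ext h')), map_zero]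
    -- A nonzero constant entry joins generators of equal degree, so only the generators of `G` in
    -- degree `j` contribute.
    have h3 : ∑ c, constantCoeff (g i a c * f i c b) =
        ∑ c with G.deg i c = j, constantCoeff (g i a c * f i c b) := by
      refine (Finset.sum_filter_of_ne fun c _ hc => ?_).symm
      rw [map_mul] at hc
      rw [← (hg i).deg_eq (left_ne_zero_of_mul hc), a.2]
    rw [h2, ← h1, h3, Finset.sum_subtype (p := fun c => G.deg i c = j) _ (by simp)]
    exact Finset.sum_congr rfl fun c _ => (map_mul _ _ _).symm
  have hinj : Function.Injective f'.mulVecLin := by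
    refine Function.LeftInverse.injective (g := g'.mulVecLin) fun v => ?_
    rw [Matrix.mulVecLin_apply, Matrix.mulVecLin_apply, Matrix.mulVec_mulVec, hgf,
      Matrix.one_mulVec]
  have := LinearMap.finrank_le_finrank_of_injective hinj
  simpa [count] using this

theorem IsMinimal.count_eq {F G : IdealResolution A} (hF : F.IsMinimal) (hG : G.IsMinimal)
    (i j : ℕ) : F.count i j = G.count i j :=
  le_antisymm (hF.count_le G i j) (hG.count_le F i j)

end IdealResolution

/-! ### The mapping cone -/

namespace IdealResolution

variable {σ k : Type*} [Field k] {A B : Ideal (MvPolynomial σ k)}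

section Cone

variable (F : IdealResolution A) (K : IdealResolution B)

/-- The index sets of the bases in the mapping cone of `F(-1) → F ⊕ K(-1)`. -/
def ConeIdx : ℕ → Type
  | 0 => F.idx 0 ⊕ K.idx 0
  | i + 1 => (F.idx (i + 1) ⊕ K.idx (i + 1)) ⊕ F.idx i

instance : ∀ i, Fintype (ConeIdx F K i)
  | 0 => inferInstanceAs (Fintype (F.idx 0 ⊕ K.idx 0))
  | i + 1 => inferInstanceAs (Fintype ((F.idx (i + 1) ⊕ K.idx (i + 1)) ⊕ F.idx i))

/-- The degrees of the basis elements in the mapping cone of `F(-1) → F ⊕ K(-1)`. -/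
def coneDeg : ∀ i, ConeIdx F K i → ℕ
  | 0 => Sum.elim (F.deg 0) (fun b => K.deg 0 b + 1)
  | i + 1 => Sum.elim (Sum.elim (F.deg (i + 1)) (fun b => K.deg (i + 1) b + 1))
      (fun a => F.deg i a + 1)

/-- The augmentation of the mapping cone of `F(-1) → F ⊕ K(-1)`. -/
noncomputable def coneAug (v : σ) : Matrix Unit (ConeIdx F K 0) (MvPolynomial σ k) :=
  (Matrix.fromCols F.aug ((X v : MvPolynomial σ k) • K.aug) :
    Matrix Unit (F.idx 0 ⊕ K.idx 0) (MvPolynomial σ k))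

open Classical in
/-- The differential of the mapping cone of the map `F(-1) → F ⊕ K(-1)` given by the
multiplication by a variable and by `-φ`. -/
noncomputable def coneD (v : σ) (φ : ∀ i, Matrix (K.idx i) (F.idx i) (MvPolynomial σ k)) :
    ∀ i, Matrix (ConeIdx F K i) (ConeIdx F K (i + 1)) (MvPolynomial σ k)
  | 0 => (Matrix.fromCols (Matrix.fromBlocks (F.d 0) 0 0 (K.d 0))
      (Matrix.fromRows ((X v : MvPolynomial σ k) • 1) (-φ 0)) :
        Matrix (F.idx 0 ⊕ K.idx 0) ((F.idx 1 ⊕ K.idx 1) ⊕ F.idx 0) (MvPolynomial σ k))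
  | i + 1 => (Matrix.fromBlocks (Matrix.fromBlocks (F.d (i + 1)) 0 0 (K.d (i + 1)))
      (Matrix.fromRows ((X v : MvPolynomial σ k) • 1) (-φ (i + 1))) 0 (-F.d i) :
        Matrix ((F.idx (i + 1) ⊕ K.idx (i + 1)) ⊕ F.idx i)
          ((F.idx (i + 2) ⊕ K.idx (i + 2)) ⊕ F.idx (i + 1)) (MvPolynomial σ k))

theorem coneAug_mulVec (v : σ) (w₁ : F.idx 0 → MvPolynomial σ k)
    (w₂ : K.idx 0 → MvPolynomial σ k) :
    coneAug F K v *ᵥ (Sum.elim w₁ w₂ : _ ⊕ _ → _) = F.aug *ᵥ w₁ + (X v : MvPolynomial σ k) • K.aug *ᵥ w₂ := by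
  change Matrix.fromCols F.aug ((X v : MvPolynomial σ k) • K.aug) *ᵥ _ = _
  simp [Matrix.fromCols_mulVec, Matrix.smul_mulVec]

theorem coneD_zero_mulVec (v : σ) (φ : ∀ i, Matrix (K.idx i) (F.idx i) (MvPolynomial σ k))
    (w₁ : F.idx 1 → MvPolynomial σ k) (w₂ : K.idx 1 → MvPolynomial σ k)
    (w₃ : F.idx 0 → MvPolynomial σ k) :
    coneD F K v φ 0 *ᵥ (Sum.elim (Sum.elim w₁ w₂) w₃ : (_ ⊕ _) ⊕ _ → _) =
      (Sum.elim (F.d 0 *ᵥ w₁ + (X v : MvPolynomial σ k) • w₃) (K.d 0 *ᵥ w₂ - φ 0 *ᵥ w₃) : _ ⊕ _ → _) := by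
  classical
  change Matrix.fromCols (Matrix.fromBlocks (F.d 0) 0 0 (K.d 0))
      (Matrix.fromRows ((X v : MvPolynomial σ k) • 1) (-φ 0)) *ᵥ _ = _
  ext (a | a) : 1 <;>
  simp [Matrix.fromCols_mulVec, Matrix.fromRows_mulVec, Matrix.fromBlocks_mulVec,
    Matrix.smul_mulVec, Matrix.neg_mulVec, sub_eq_add_neg]

theorem coneD_succ_mulVec (v : σ) (φ : ∀ i, Matrix (K.idx i) (F.idx i) (MvPolynomial σ k)) (i : ℕ)
    (w₁ : F.idx (i + 2) → MvPolynomial σ k) (w₂ : K.idx (i + 2) → MvPolynomial σ k)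
    (w₃ : F.idx (i + 1) → MvPolynomial σ k) :
    coneD F K v φ (i + 1) *ᵥ (Sum.elim (Sum.elim w₁ w₂) w₃ : (_ ⊕ _) ⊕ _ → _) =
      (Sum.elim (Sum.elim (F.d (i + 1) *ᵥ w₁ + (X v : MvPolynomial σ k) • w₃)
        (K.d (i + 1) *ᵥ w₂ - φ (i + 1) *ᵥ w₃)) (-(F.d i *ᵥ w₃)) : (_ ⊕ _) ⊕ _ → _) := by
  classical
  change Matrix.fromBlocks (Matrix.fromBlocks (F.d (i + 1)) 0 0 (K.d (i + 1)))
      (Matrix.fromRows ((X v : MvPolynomial σ k) • 1) (-φ (i + 1))) 0 (-F.d i) *ᵥ _ = _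
  ext ((a | a) | a) : 1 <;>
  simp [Matrix.fromRows_mulVec, Matrix.fromBlocks_mulVec,
    Matrix.smul_mulVec, Matrix.neg_mulVec, sub_eq_add_neg]

theorem coneAug_homogeneous (v : σ) :
    IsHomogeneousMatrix (fun _ => 0) (coneDeg F K 0) (coneAug F K v) := by
  classical
  rintro a (b | b) s h
  · exact F.aug_homogeneous a b s h
  · change coeff s (X v * K.aug a b) ≠ 0 at h
    rw [coeff_X_mul'] at h
    split_ifs at h with hs
    · have h0 : (s - Finsupp.single v 1).degree + 0 = K.deg 0 b := K.aug_homogeneous a b _ h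
      have h1 : Finsupp.single v 1 ≤ s := by
        rw [Finsupp.single_le_iff]
        exact Nat.one_le_iff_ne_zero.2 (Finsupp.mem_support_iff.1 hs)
      have h2 : (s - Finsupp.single v 1).degree + 1 = s.degree := by
        conv_rhs => rw [← tsub_add_cancel_of_le h1, map_add, Finsupp.degree_single]
      change s.degree + 0 = K.deg 0 b + 1
      omega
    · exact absurd rfl h

theorem isHomogeneousMatrix_X_smul_one {α : Type*} [DecidableEq α] (deg : α → ℕ) (v : σ) :
    IsHomogeneousMatrix (k := k) deg (fun a => deg a + 1)
      ((X v : MvPolynomial σ k) • (1 : Matrix α α (MvPolynomial σ k))) := by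
  classical
  intro a b s h
  by_cases hab : a = b
  · subst hab
    rw [Matrix.smul_apply, Matrix.one_apply_eq, smul_eq_mul, mul_one, coeff_X] at h
    have : Finsupp.single v 1 = s := by
      by_contra h0
      exact h (if_neg h0)
    rw [← this, Finsupp.degree_single, add_comm]
  · rw [Matrix.smul_apply, Matrix.one_apply_ne hab] at h
    simp at h

theorem coneD_homogeneous (v : σ) (φ : ∀ i, Matrix (K.idx i) (F.idx i) (MvPolynomial σ k))
    (hφ : ∀ i, IsHomogeneousMatrix (K.deg i) (F.deg i) (φ i)) (i : ℕ) :
    IsHomogeneousMatrix (coneDeg F K i) (coneDeg F K (i + 1)) (coneD F K v φ i) := by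
  classical
  have hneg : ∀ {α β : Type} (dα : α → ℕ) (dβ : β → ℕ) (M : Matrix α β (MvPolynomial σ k)),
      IsHomogeneousMatrix dα dβ M →
        IsHomogeneousMatrix (fun a => dα a + 1) (fun b => dβ b + 1) (-M) := by
    intro α β dα dβ M hM a b s h
    have := hM a b s (by simpa using h)
    change s.degree + (dα a + 1) = dβ b + 1
    omega
  have hsh : ∀ {α β : Type} (dα : α → ℕ) (dβ : β → ℕ) (M : Matrix α β (MvPolynomial σ k)),
      IsHomogeneousMatrix dα dβ M →
        IsHomogeneousMatrix (fun a => dα a + 1) (fun b => dβ b + 1) M := by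
    intro α β dα dβ M hM a b s h
    have := hM a b s h
    change s.degree + (dα a + 1) = dβ b + 1
    omega
  cases i with
  | zero =>
    rintro (a | a) ((b | b) | b) s h
    · exact F.d_homogeneous 0 a b s h
    · exact absurd (coeff_zero s) h
    · exact isHomogeneousMatrix_X_smul_one (F.deg 0) v a b s h
    · exact absurd (coeff_zero s) h
    · exact hsh _ _ _ (K.d_homogeneous 0) a b s h
    · exact hneg _ _ _ (hφ 0) a b s h
  | succ i =>
    rintro ((a | a) | a) ((b | b) | b) s h
    · exact F.d_homogeneous (i + 1) a b s h
    · exact absurd (coeff_zero s) h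
    · exact isHomogeneousMatrix_X_smul_one (F.deg (i + 1)) v a b s h
    · exact absurd (coeff_zero s) h
    · exact hsh _ _ _ (K.d_homogeneous (i + 1)) a b s h
    · exact hneg _ _ _ (hφ (i + 1)) a b s h
    · exact absurd (coeff_zero s) h
    · exact absurd (coeff_zero s) h
    · exact hneg _ _ _ (F.d_homogeneous i) a b s h

theorem constantCoeff_coneD (hF : F.IsMinimal) (hK : K.IsMinimal) (v : σ)
    (φ : ∀ i, Matrix (K.idx i) (F.idx i) (MvPolynomial σ k))
    (hφ : ∀ i a b, constantCoeff (φ i a b) = 0) (i : ℕ) (a : ConeIdx F K i)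
    (b : ConeIdx F K (i + 1)) : constantCoeff (coneD F K v φ i a b) = 0 := by
  classical
  have hX : ∀ {α : Type} (a b : α),
      constantCoeff (((X v : MvPolynomial σ k) • (1 : Matrix α α (MvPolynomial σ k))) a b) = 0 := by
    intro α a b
    rw [Matrix.smul_apply, smul_eq_mul, map_mul, constantCoeff_X, zero_mul]
  have hneg : ∀ {α β : Type} (M : Matrix α β (MvPolynomial σ k)) a b,
      constantCoeff (M a b) = 0 → constantCoeff ((-M) a b) = 0 := by
    intro α β M a b h
    rw [Matrix.neg_apply, map_neg, h, neg_zero]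
  cases i with
  | zero =>
    rcases a with a | a <;> rcases b with (b | b) | b
    · exact hF 0 a b
    · exact map_zero _
    · exact hX a b
    · exact map_zero _
    · exact hK 0 a b
    · exact hneg _ a b (hφ 0 a b)
  | succ i =>
    rcases a with (a | a) | a <;> rcases b with (b | b) | b
    · exact hF (i + 1) a b
    · exact map_zero _
    · exact hX a b
    · exact map_zero _
    · exact hK (i + 1) a b
    · exact hneg _ a b (hφ (i + 1) a b)
    · exact map_zero _
    · exact map_zero _
    · exact hneg _ a b (hF i a b)

variable {F K}

theorem exists_sum_elim {α β R : Type*} (w : α ⊕ β → R) : ∃ w₁ w₂, w = Sum.elim w₁ w₂ :=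
  ⟨_, _, (Sum.elim_comp_inl_inr w).symm⟩

theorem sum_elim_eq_zero_iff {α β R : Type*} [Zero R] {a : α → R} {b : β → R} :
    Sum.elim a b = 0 ↔ a = 0 ∧ b = 0 := by
  rw [← Sum.elim_eq_iff, Sum.elim_zero_zero]

/-- The step common to the exactness proofs for the mapping cone. -/
theorem cone_lift {R α β α' β' α'' β'' : Type*} [CommRing R] [Fintype α] [Fintype β] [Fintype α']
    [Fintype β'] [Fintype α''] {x : R}
    {D : Matrix α'' α R} {D' : Matrix α α' R} {E : Matrix β'' β R} {E' : Matrix β β' R}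
    (hD : IsExactPair D D') (hE : IsExactPair E E') {φ : Matrix β α R} {ψ : Matrix β'' α'' R}
    (hφ : E * φ = ψ * D) {w₁ : α → R} {w₂ : β → R} {w₃ : α'' → R} {u : α → R}
    (h₁ : D *ᵥ w₁ + x • w₃ = 0) (h₂ : E *ᵥ w₂ - ψ *ᵥ w₃ = 0) (hu : D *ᵥ u = w₃) :
    ∃ v₁ v₂, D' *ᵥ v₁ + x • (-u) = w₁ ∧ E' *ᵥ v₂ - φ *ᵥ (-u) = w₂ := by
  -- Once `-u` is taken as third coordinate of the preimage, the remainders `w₁ + x u` and `w₂ - φ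
  -- u` are cycles and lift separately.
  obtain ⟨v₁, hv₁⟩ := (hD (w₁ + x • u)).1 (by rw [Matrix.mulVec_add, Matrix.mulVec_smul, hu, h₁])
  obtain ⟨v₂, hv₂⟩ := (hE (w₂ - φ *ᵥ u)).1 (by
    rw [Matrix.mulVec_sub, Matrix.mulVec_mulVec, hφ, ← Matrix.mulVec_mulVec, hu, h₂])
  refine ⟨v₁, v₂, ?_, ?_⟩
  · rw [hv₁, smul_neg, add_neg_cancel_right]
  · rw [hv₂, Matrix.mulVec_neg, sub_neg_eq_add, sub_add_cancel]

/-- This is where `A ∩ x B = x A` enters: a relation `a + x b = 0` with `a ∈ A`, `b ∈ B` forces `b ∈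
A`, so it comes from the third summand of the cone. -/
theorem cone_exact_zero {v : σ} (hA : ∀ p, X v * p ∈ A → p ∈ A)
    {φ : ∀ i, Matrix (K.idx i) (F.idx i) (MvPolynomial σ k)} (hφ0 : K.aug * φ 0 = F.aug) :
    IsExactPair (coneAug F K v) (coneD F K v φ 0) := by
  intro w
  constructor
  · intro hw
    obtain ⟨w₁, w₂, rfl⟩ := exists_sum_elim (α := F.idx 0) (β := K.idx 0) w
    rw [coneAug_mulVec] at hw
    have hw' := congrFun hw ()
    have h1 : (K.aug *ᵥ w₂) () ∈ A := by
      apply hA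
      refine (F.mem_iff _).2 ⟨-w₁, ?_⟩
      rw [Matrix.mulVec_neg]
      exact neg_eq_of_add_eq_zero_right hw'
    obtain ⟨u, hu⟩ := (F.mem_iff _).1 h1
    have hu' : F.aug *ᵥ u = K.aug *ᵥ w₂ := funext fun _ => hu
    -- The augmentations play the part of the differentials, with `ψ = 1` on the rank-one module and
    -- `K.aug *ᵥ w₂` as third coordinate.
    have hlift := cone_lift (x := X v) (u := u) (φ := φ 0) (ψ := 1) F.exact_zero K.exact_zero
      (by rw [hφ0, Matrix.one_mul]) hw (by rw [Matrix.one_mulVec, sub_self]) hu'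
    obtain ⟨v₁, v₂, hv₁, hv₂⟩ := hlift
    refine ⟨Sum.elim (Sum.elim v₁ v₂) (-u), ?_⟩
    exact (coneD_zero_mulVec F K v φ v₁ v₂ (-u)).trans (by rw [hv₁, hv₂])
  · rintro ⟨w, rfl⟩
    obtain ⟨w', w₃, rfl⟩ := exists_sum_elim (α := F.idx 1 ⊕ K.idx 1) (β := F.idx 0) w
    obtain ⟨w₁, w₂, rfl⟩ := exists_sum_elim w'
    rw [coneD_zero_mulVec, coneAug_mulVec, Matrix.mulVec_add, Matrix.mulVec_sub,
      (F.exact_zero _).2 ⟨_, rfl⟩, (K.exact_zero _).2 ⟨_, rfl⟩, Matrix.mulVec_smul,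
      Matrix.mulVec_mulVec, hφ0, zero_add, zero_sub, smul_neg, add_neg_cancel]

theorem cone_exact_one {v : σ}
    {φ : ∀ i, Matrix (K.idx i) (F.idx i) (MvPolynomial σ k)}
    (hφ : ∀ i, K.d i * φ (i + 1) = φ i * F.d i) :
    IsExactPair (coneD F K v φ 0) (coneD F K v φ 1) := by
  intro w
  constructor
  · intro hw
    obtain ⟨w', w₃, rfl⟩ := exists_sum_elim (α := F.idx 1 ⊕ K.idx 1) (β := F.idx 0) w
    obtain ⟨w₁, w₂, rfl⟩ := exists_sum_elim w'
    rw [coneD_zero_mulVec] at hw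
    obtain ⟨h₁, h₂⟩ := sum_elim_eq_zero_iff.1 hw
    -- No component of the cone differential records the augmentation of `w₃` here. Applying `F.aug`
    -- to `h₁` gives `x · aug w₃ = 0`, and `x` is cancelled in the polynomial ring.
    obtain ⟨u, hu⟩ := (F.exact_zero w₃).1 (by
      have h3 := congrArg (fun y => F.aug *ᵥ y) h₁
      simp only [Matrix.mulVec_add, (F.exact_zero _).2 ⟨_, rfl⟩, Matrix.mulVec_smul, zero_add,
        Matrix.mulVec_zero] at h3
      funext a
      exact (mul_eq_zero.1 (congrFun h3 a)).resolve_left (X_ne_zero v))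
    obtain ⟨v₁, v₂, hv₁, hv₂⟩ := cone_lift (F.exact_succ 0) (K.exact_succ 0) (hφ 0) h₁ h₂ hu
    refine ⟨Sum.elim (Sum.elim v₁ v₂) (-u), ?_⟩
    rw [coneD_succ_mulVec, hv₁, hv₂, Matrix.mulVec_neg, hu, neg_neg]
  · rintro ⟨w, rfl⟩
    obtain ⟨w', w₃, rfl⟩ := exists_sum_elim (α := F.idx 2 ⊕ K.idx 2) (β := F.idx 1) w
    obtain ⟨w₁, w₂, rfl⟩ := exists_sum_elim w'
    rw [coneD_succ_mulVec, coneD_zero_mulVec]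
    refine sum_elim_eq_zero_iff.2 ⟨?_, ?_⟩
    · rw [Matrix.mulVec_add, (F.exact_succ 0 _).2 ⟨_, rfl⟩, Matrix.mulVec_smul, zero_add, smul_neg,
        add_neg_cancel]
    · rw [Matrix.mulVec_sub, (K.exact_succ 0 _).2 ⟨_, rfl⟩, Matrix.mulVec_neg,
        Matrix.mulVec_mulVec, Matrix.mulVec_mulVec, hφ, zero_sub, sub_neg_eq_add, neg_add_cancel]

theorem cone_exact_add_two {v : σ}
    {φ : ∀ i, Matrix (K.idx i) (F.idx i) (MvPolynomial σ k)}
    (hφ : ∀ i, K.d i * φ (i + 1) = φ i * F.d i) (i : ℕ) :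
    IsExactPair (coneD F K v φ (i + 1)) (coneD F K v φ (i + 2)) := by
  intro w
  constructor
  · intro hw
    obtain ⟨w', w₃, rfl⟩ :=
      exists_sum_elim (α := F.idx (i + 2) ⊕ K.idx (i + 2)) (β := F.idx (i + 1)) w
    obtain ⟨w₁, w₂, rfl⟩ := exists_sum_elim w'
    rw [coneD_succ_mulVec] at hw
    obtain ⟨h₁₂, h₃⟩ := sum_elim_eq_zero_iff.1 hw
    obtain ⟨h₁, h₂⟩ := sum_elim_eq_zero_iff.1 h₁₂
    obtain ⟨u, hu⟩ := (F.exact_succ i w₃).1 (neg_eq_zero.1 h₃)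
    obtain ⟨v₁, v₂, hv₁, hv₂⟩ :=
      cone_lift (F.exact_succ (i + 1)) (K.exact_succ (i + 1)) (hφ (i + 1)) h₁ h₂ hu
    refine ⟨Sum.elim (Sum.elim v₁ v₂) (-u), ?_⟩
    rw [coneD_succ_mulVec, hv₁, hv₂, Matrix.mulVec_neg, hu, neg_neg]
  · rintro ⟨w, rfl⟩
    obtain ⟨w', w₃, rfl⟩ :=
      exists_sum_elim (α := F.idx (i + 3) ⊕ K.idx (i + 3)) (β := F.idx (i + 2)) w
    obtain ⟨w₁, w₂, rfl⟩ := exists_sum_elim w'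
    rw [coneD_succ_mulVec, coneD_succ_mulVec]
    refine sum_elim_eq_zero_iff.2 ⟨sum_elim_eq_zero_iff.2 ⟨?_, ?_⟩, ?_⟩
    · rw [Matrix.mulVec_add, (F.exact_succ _ _).2 ⟨_, rfl⟩, Matrix.mulVec_smul, zero_add, smul_neg,
        add_neg_cancel]
    · rw [Matrix.mulVec_sub, (K.exact_succ _ _).2 ⟨_, rfl⟩, Matrix.mulVec_neg,
        Matrix.mulVec_mulVec, Matrix.mulVec_mulVec, hφ, zero_sub, sub_neg_eq_add, neg_add_cancel]
    · rw [Matrix.mulVec_neg, (F.exact_succ _ _).2 ⟨_, rfl⟩, neg_zero, neg_zero]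

/-- `hA` gives exactness at the bottom; `hdeg` makes every constant entry of the lift `φ` vanish,
which is what minimality of the cone needs. -/
theorem exists_cone (F : IdealResolution A) (K : IdealResolution B) (v : σ) (hAB : A ≤ B)
    (hA : ∀ p, X v * p ∈ A → p ∈ A) (hF : F.IsMinimal) (hK : K.IsMinimal)
    (hdeg : ∀ i a b, K.deg i a ≠ F.deg i b) :
    ∃ G : IdealResolution (A ⊔ Ideal.span {X v} * B), G.IsMinimal ∧
      ∃ e : ∀ i, G.idx i ≃ ConeIdx F K i, ∀ i a, G.deg i a = coneDeg F K i (e i a) := by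
  obtain ⟨φ, hφh, hφ0, hφ⟩ := F.exists_lift K hAB
  refine ⟨{
    idx := ConeIdx F K
    deg := coneDeg F K
    aug := coneAug F K v
    d := coneD F K v φ
    aug_homogeneous := coneAug_homogeneous F K v
    d_homogeneous := coneD_homogeneous F K v φ hφh
    mem_iff := ?_
    exact_zero := cone_exact_zero hA hφ0
    exact_succ := ?_ }, ?_, fun i => Equiv.refl _, fun i a => rfl⟩
  · intro p
    rw [Submodule.mem_sup]
    constructor
    · rintro ⟨y, hy, z, hz, rfl⟩
      obtain ⟨b, hb, rfl⟩ := Ideal.mem_span_singleton_mul.1 hz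
      obtain ⟨w₁, rfl⟩ := (F.mem_iff y).1 hy
      obtain ⟨w₂, rfl⟩ := (K.mem_iff b).1 hb
      refine ⟨Sum.elim w₁ w₂, ?_⟩
      rw [coneAug_mulVec]
      rfl
    · rintro ⟨w, rfl⟩
      obtain ⟨w₁, w₂, rfl⟩ := exists_sum_elim (α := F.idx 0) (β := K.idx 0) w
      refine ⟨_, (F.mem_iff _).2 ⟨w₁, rfl⟩, _, Ideal.mem_span_singleton_mul.2
        ⟨_, (K.mem_iff _).2 ⟨w₂, rfl⟩, rfl⟩, ?_⟩
      rw [coneAug_mulVec]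
      rfl
  · rintro (_ | i)
    · exact cone_exact_one hφ
    · exact cone_exact_add_two hφ i
  · refine constantCoeff_coneD F K hF hK v φ fun i a b => ?_
    by_contra h
    exact hdeg i a b ((hφh i).deg_eq h)

end Cone

end IdealResolution

/-! ### The Koszul resolution -/

namespace IdealResolution

variable {σ k : Type*} [Field k]

section Koszul

/-- The resolution of the zero ideal by zero modules. -/
noncomputable def ofBot (σ k : Type*) [Field k] : IdealResolution (⊥ : Ideal (MvPolynomial σ k)) where
  idx _ := Empty
  deg _ := Empty.elim
  aug := 0
  d _ := 0
  aug_homogeneous _ b := b.elim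
  d_homogeneous _ b := b.elim
  mem_iff p := by simp [eq_comm]
  exact_zero w := ⟨fun _ => ⟨0, Subsingleton.elim _ _⟩, fun _ => by simp⟩
  exact_succ _ w := ⟨fun _ => ⟨0, Subsingleton.elim _ _⟩, fun _ => by simp⟩

/-- The index sets of a module of rank one concentrated in homological degree `0`. -/
def UnitIdx : ℕ → Type
  | 0 => Unit
  | _ + 1 => Empty

instance : ∀ i, Fintype (UnitIdx i)
  | 0 => inferInstanceAs (Fintype Unit)
  | _ + 1 => inferInstanceAs (Fintype Empty)

theorem unitIdx_mulVec {R : Type*} [CommRing R] (w : UnitIdx 0 → R) :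
    (fun _ _ => 1 : Matrix Unit (UnitIdx 0) R) *ᵥ w = w := by
  funext a
  exact (Fintype.sum_unique (ι := Unit) fun x => 1 * w x).trans (one_mul _)

/-- The resolution of the unit ideal by the polynomial ring. -/
noncomputable def ofTop (σ k : Type*) [Field k] :
    IdealResolution (⊤ : Ideal (MvPolynomial σ k)) where
  idx := UnitIdx
  deg _ _ := 0
  aug _ _ := 1
  d _ := 0
  aug_homogeneous a b s h := by
    classical
    rw [coeff_one] at h
    by_cases hs : 0 = s
    · simp [← hs]
    · exact absurd (if_neg hs) h
  d_homogeneous i a b := b.elim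
  mem_iff p := ⟨fun _ => ⟨fun _ => p, congrFun (unitIdx_mulVec fun _ => p) ()⟩, fun _ => trivial⟩
  exact_zero w := by
    constructor
    · intro hw
      exact ⟨0, by rw [Matrix.mulVec_zero]; exact ((unitIdx_mulVec w).symm.trans hw).symm⟩
    · rintro ⟨v, rfl⟩
      rw [Matrix.zero_mulVec]
      exact unitIdx_mulVec 0
  exact_succ i w := ⟨fun _ => ⟨0, funext fun a => Empty.elim a⟩, fun _ => Matrix.zero_mulVec _⟩

theorem mem_span_X_image_of_X_mul_mem {T : Set σ} {w : σ} (hw : w ∉ T) (p : MvPolynomial σ k)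
    (h : X w * p ∈ Ideal.span (X '' T : Set (MvPolynomial σ k))) :
    p ∈ Ideal.span (X '' T : Set (MvPolynomial σ k)) := by
  classical
  rw [mem_ideal_span_X_image] at h ⊢
  intro m hm
  obtain ⟨i, hi, him⟩ := h (Finsupp.single w 1 + m) (by
    rw [mem_support_iff, coeff_X_mul]
    exact mem_support_iff.1 hm)
  refine ⟨i, hi, ?_⟩
  rwa [Finsupp.add_apply, Finsupp.single_eq_of_ne (by rintro rfl; exact hw hi), zero_add] at him

/-- The Koszul complex on a finite set of variables. -/
theorem exists_koszul (T : Finset σ) :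
    ∃ F : IdealResolution (Ideal.span (X '' (T : Set σ) : Set (MvPolynomial σ k))), F.IsMinimal ∧
      (∀ i, Fintype.card (F.idx i) = T.card.choose (i + 1)) ∧ ∀ i a, F.deg i a = i + 1 := by
  classical
  induction T using Finset.induction_on with
  | empty =>
    rw [Finset.coe_empty, Set.image_empty, Ideal.span_empty]
    exact ⟨ofBot σ k, fun i a => a.elim, fun i => by
      rw [Finset.card_empty, Nat.choose_zero_succ]
      exact Fintype.card_empty, fun i a => a.elim⟩
  | insert w T hw ih =>
    obtain ⟨F, hF, hcard, hdeg⟩ := ih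
    -- Adding a variable is the same cone construction for `(T) + x_w · (1)`. The counts then add up
    -- by Pascal's rule.
    obtain ⟨G, hG, e, he⟩ := F.exists_cone (ofTop σ k) w le_top
      (mem_span_X_image_of_X_mul_mem (by exact_mod_cast hw)) hF (fun i a b => map_zero _)
      (fun i a b => by
        rw [hdeg]
        exact (Nat.succ_ne_zero i).symm)
    have hI : Ideal.span (X '' ((insert w T : Finset σ) : Set σ) : Set (MvPolynomial σ k)) =
        Ideal.span (X '' (T : Set σ)) ⊔ Ideal.span {X w} * ⊤ := by
      rw [Ideal.mul_top, Finset.coe_insert, Set.image_insert_eq, Ideal.span_insert, sup_comm]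
    rw [hI]
    refine ⟨G, hG, fun i => ?_, fun i a => ?_⟩
    · rw [Fintype.card_congr (e i), Finset.card_insert_of_notMem hw]
      cases i with
      | zero =>
        have h : Fintype.card (F.idx 0 ⊕ Unit) = (T.card + 1).choose 1 := by
          rw [Fintype.card_sum, hcard]
          simp
        exact h
      | succ i =>
        have h : Fintype.card ((F.idx (i + 1) ⊕ Empty) ⊕ F.idx i) = (T.card + 1).choose (i + 2) := by
          rw [Fintype.card_sum, Fintype.card_sum, hcard, hcard, Nat.choose_succ_succ' T.card (i + 1)]
          simp [add_comm]
        exact h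
    · rw [he]
      generalize e i a = b
      cases i with
      | zero =>
        rcases b with b | b
        · exact hdeg 0 b
        · rfl
      | succ i =>
        rcases b with (b | b) | b
        · exact hdeg (i + 1) b
        · exact b.elim
        · exact congrArg (· + 1) (hdeg i b)

end Koszul

/-! ### Adjoining a variable -/

section Extension

variable {V : Type*}

theorem optionEquivLeft_rename_some (p : MvPolynomial V k) :
    optionEquivLeft k V (rename some p) = Polynomial.C p := by
  induction p using MvPolynomial.induction_on with
  | C a => rw [rename_C, optionEquivLeft_C]
  | add p q hp hq => rw [map_add, map_add, hp, hq, Polynomial.C_add]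
  | mul_X p v hp => rw [map_mul, map_mul, hp, rename_X, optionEquivLeft_X_some, Polynomial.C_mul]

theorem coeff_optionEquivLeft_mulVec {α β : Type*} [Fintype β] (M : Matrix α β (MvPolynomial V k))
    (w : β → MvPolynomial (Option V) k) (n : ℕ) (a : α) :
    (optionEquivLeft k V ((M.map (rename some) *ᵥ w) a)).coeff n =
      (M *ᵥ fun b => (optionEquivLeft k V (w b)).coeff n) a := by
  rw [Matrix.mulVec, dotProduct, map_sum, Polynomial.finsetSum_coeff]
  refine Finset.sum_congr rfl fun b _ => ?_
  rw [Matrix.map_apply, map_mul, optionEquivLeft_rename_some, Polynomial.coeff_C_mul]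

/-- Viewed over `k[V][X]`, the extended matrices have constant polynomials as entries, so they act
on each coefficient separately and exactness is checked coefficient by coefficient. -/
theorem _root_.IsExactPair.map_rename_some {α β γ : Type*} [Fintype β] [Fintype γ]
    {D : Matrix α β (MvPolynomial V k)} {E : Matrix β γ (MvPolynomial V k)}
    (h : IsExactPair D E) :
    IsExactPair (D.map (rename some) : Matrix α β (MvPolynomial (Option V) k))
      (E.map (rename some)) := by
  classical
  intro w
  constructor
  · intro hw
    have h1 : ∀ n, ∃ v, E *ᵥ v = fun b => (optionEquivLeft k V (w b)).coeff n := by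
      intro n
      refine (h _).1 (funext fun a => ?_)
      rw [← coeff_optionEquivLeft_mulVec, hw, Pi.zero_apply, map_zero, Polynomial.coeff_zero,
        Pi.zero_apply]
    choose v hv using h1
    -- A bound beyond all degrees of `w`: the chosen preimages are truncated there to form a
    -- polynomial.
    let N := ∑ b, ((optionEquivLeft k V (w b)).natDegree + 1)
    refine ⟨fun c => (optionEquivLeft k V).symm
      (∑ n ∈ Finset.range N, Polynomial.monomial n (v n c)), funext fun b => ?_⟩
    apply (optionEquivLeft k V).injective
    ext1 n
    rw [coeff_optionEquivLeft_mulVec]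
    simp only [AlgEquiv.apply_symm_apply, Polynomial.finsetSum_coeff, Polynomial.coeff_monomial,
      Finset.sum_ite_eq', Finset.mem_range]
    by_cases hn : n < N
    · simp only [if_pos hn]
      exact congrFun (hv n) b
    · simp only [if_neg hn]
      have h2 := Finset.single_le_sum (f := fun b => (optionEquivLeft k V (w b)).natDegree + 1)
        (fun _ _ => Nat.zero_le _) (Finset.mem_univ b)
      have h3 : (optionEquivLeft k V (w b)).natDegree + 1 ≤ N := h2
      rw [Polynomial.coeff_eq_zero_of_natDegree_lt (by omega)]
      exact congrFun (Matrix.mulVec_zero E) b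
  · rintro ⟨v, rfl⟩
    have h1 : (D.map (rename some) : Matrix α β (MvPolynomial (Option V) k)) *
        E.map (rename some) = (D * E).map (rename some) :=
      (Matrix.map_mul (f := (rename some : MvPolynomial V k →ₐ[k] MvPolynomial (Option V) k))).symm
    rw [Matrix.mulVec_mulVec, h1, h.mul_eq_zero, Matrix.map_zero _ (map_zero _), Matrix.zero_mulVec]

theorem _root_.IsHomogeneousMatrix.map_rename {α β W : Type*} {degα : α → ℕ} {degβ : β → ℕ}
    {M : Matrix α β (MvPolynomial V k)} (hM : IsHomogeneousMatrix degα degβ M) (f : V → W) :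
    IsHomogeneousMatrix degα degβ (M.map (rename f)) := by
  intro a b s h
  obtain ⟨u, rfl, hu⟩ := coeff_rename_ne_zero f _ _ h
  rw [Finsupp.degree_mapDomain]
  exact hM a b u hu

/-- The extension of a resolution to a polynomial ring with one more variable. -/
noncomputable def extend {A : Ideal (MvPolynomial V k)} (F : IdealResolution A) :
    IdealResolution (A.map (rename some : MvPolynomial V k →ₐ[k] MvPolynomial (Option V) k)) where
  idx := F.idx
  deg := F.deg
  aug := F.aug.map (rename some)
  d i := (F.d i).map (rename some)
  aug_homogeneous := F.aug_homogeneous.map_rename _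
  d_homogeneous i := (F.d_homogeneous i).map_rename _
  mem_iff p := by
    classical
    constructor
    · intro hp
      induction hp using Submodule.span_induction with
      | mem x hx =>
        obtain ⟨q, hq, rfl⟩ := hx
        obtain ⟨w, rfl⟩ := (F.mem_iff q).1 hq
        refine ⟨fun a => rename some (w a), ?_⟩
        simp [Matrix.mulVec, dotProduct]
      | zero => exact ⟨0, by rw [Matrix.mulVec_zero, Pi.zero_apply]⟩
      | add x y _ _ hx hy =>
        obtain ⟨w, rfl⟩ := hx
        obtain ⟨w', rfl⟩ := hy
        exact ⟨w + w', by rw [Matrix.mulVec_add, Pi.add_apply]⟩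
      | smul c x _ hx =>
        obtain ⟨w, rfl⟩ := hx
        exact ⟨c • w, by rw [Matrix.mulVec_smul, Pi.smul_apply]⟩
    · rintro ⟨w, rfl⟩
      refine Ideal.sum_mem _ fun a _ => Ideal.mul_mem_right _ _ (Ideal.mem_map_of_mem _ ?_)
      exact (F.mem_iff _).2 ⟨Pi.single a 1, by simp⟩
  exact_zero := F.exact_zero.map_rename_some
  exact_succ i := (F.exact_succ i).map_rename_some

theorem IsMinimal.extend {A : Ideal (MvPolynomial V k)} {F : IdealResolution A}
    (hF : F.IsMinimal) : F.extend.IsMinimal := fun i a b =>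
  (constantCoeff_rename _ _).trans (hF i a b)

/-- A polynomial lies in the extended ideal exactly when all its coefficients as a polynomial in the
new variable lie in `A`; multiplication by that variable only shifts them. -/
theorem mem_map_rename_some_of_X_none_mul_mem (A : Ideal (MvPolynomial V k))
    (p : MvPolynomial (Option V) k)
    (h : X none * p ∈
      A.map (rename some : MvPolynomial V k →ₐ[k] MvPolynomial (Option V) k)) :
    p ∈ A.map (rename some : MvPolynomial V k →ₐ[k] MvPolynomial (Option V) k) := by
  have key : ∀ q, q ∈ A.map (rename some : MvPolynomial V k →ₐ[k] MvPolynomial (Option V) k) ↔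
      ∀ n, (optionEquivLeft k V q).coeff n ∈ A := by
    intro q
    rw [← Ideal.mem_map_C_iff]
    constructor
    · intro hq
      refine (Ideal.map_le_iff_le_comap.2 fun r hr => ?_ :
        A.map (rename some : MvPolynomial V k →ₐ[k] MvPolynomial (Option V) k) ≤
          (A.map Polynomial.C).comap (optionEquivLeft k V)) hq
      change optionEquivLeft k V (rename some r) ∈ A.map Polynomial.C
      rw [optionEquivLeft_rename_some]
      exact Ideal.mem_map_of_mem _ hr
    · intro hq
      have h1 := (Ideal.map_le_iff_le_comap.2 fun r hr => ?_ : A.map Polynomial.C ≤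
        (A.map (rename some : MvPolynomial V k →ₐ[k] MvPolynomial (Option V) k)).comap
          (optionEquivLeft k V).symm) hq
      · rwa [Ideal.mem_comap, AlgEquiv.symm_apply_apply] at h1
      · change (optionEquivLeft k V).symm (Polynomial.C r) ∈
          A.map (rename some : MvPolynomial V k →ₐ[k] MvPolynomial (Option V) k)
        rw [← optionEquivLeft_rename_some, AlgEquiv.symm_apply_apply]
        exact Ideal.mem_map_of_mem _ hr
  rw [key] at h ⊢
  intro n
  have := h (n + 1)
  rwa [map_mul, optionEquivLeft_X_none, Polynomial.coeff_X_mul] at this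

end Extension

/-! ### Degree bound for minimal resolutions -/

theorem IsMinimal.add_two_le_deg {A : Ideal (MvPolynomial σ k)} {F : IdealResolution A}
    (hF : F.IsMinimal) (hA : ∀ p ∈ A, ∀ s, coeff s p ≠ 0 → 2 ≤ s.degree) (i : ℕ) (a : F.idx i) :
    i + 2 ≤ F.deg i a := by
  classical
  -- A zero column would make a basis vector a cycle, hence a boundary, but boundaries have entries
  -- without constant term. A nonzero entry then forces the degree up by at least one at each step.
  have hcol : ∀ {i : ℕ} {α : Type} {D : Matrix α (F.idx i) (MvPolynomial σ k)},
      IsExactPair D (F.d i) → ∀ a, ∃ b, D b a ≠ 0 := by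
    intro i α D hD a
    by_contra! h
    obtain ⟨v, hv⟩ := (hD (Pi.single a 1)).1 (funext fun b => by simpa using h b)
    have h1 := congrArg constantCoeff (congrFun hv a)
    rw [Pi.single_eq_same, map_one, Matrix.mulVec, dotProduct, map_sum, Finset.sum_eq_zero] at h1
    · exact zero_ne_one h1
    · intro c _
      rw [map_mul, hF, zero_mul]
  induction i with
  | zero =>
    obtain ⟨b, hb⟩ := hcol F.exact_zero a
    obtain ⟨s, hs⟩ := ne_zero_iff.1 hb
    have h1 := F.aug_homogeneous b a s hs
    have h2 := hA _ ((F.mem_iff _).2 ⟨Pi.single a 1, by simp⟩) s hs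
    simp only at h1
    omega
  | succ i ih =>
    obtain ⟨b, hb⟩ := hcol (F.exact_succ i) a
    obtain ⟨s, hs⟩ := ne_zero_iff.1 hb
    have h1 := F.d_homogeneous i b a s hs
    have h2 := ih b
    have h3 : s.degree ≠ 0 := by
      intro h0
      rw [Finsupp.degree_eq_zero_iff] at h0
      rw [h0] at hs
      exact hs (hF i b a)
    omega

end IdealResolution

/-! ### From resolutions of the quotient to resolutions of the ideal -/

/-- Minimality forces `F₀` to be free of rank one on a generator of degree `0`, so removing it
leaves a resolution of `I` with homological index lowered by one. -/
theorem MinimalGradedFreeResolution.exists_idealResolution {σ k : Type*} [Field k]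
    {I : Ideal (MvPolynomial σ k)} (R : MinimalGradedFreeResolution I) (hI : (1 : _) ∉ I) :
    ∃ F : IdealResolution I, F.IsMinimal ∧ (∀ i j, R.betti (i + 1) j = F.count i j) ∧
      ∀ j, R.betti 0 j = if j = 0 then 1 else 0 := by
  classical
  choose p hp hpa using R.aug_homogeneous
  obtain ⟨w, hw⟩ := R.aug_surjective (Ideal.Quotient.mk I 1)
  have hd : ∀ v b, constantCoeff (R.d 0 v b) = 0 := by
    intro v b
    rw [← LinearMap.toMatrix'_mulVec, Matrix.mulVec, dotProduct, map_sum]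
    refine Finset.sum_eq_zero fun c _ => ?_
    rw [map_mul, LinearMap.toMatrix'_apply, R.minimal, zero_mul]
  -- As `w` maps to `1`, the vector `e_a - p_a w` lies in the kernel of the augmentation, hence has
  -- no constant terms. So the identity matrix is a product of a column and a row, which leaves at
  -- most one index.
  have hδ : ∀ a b, (if b = a then (1 : k) else 0) = constantCoeff (p a) * constantCoeff (w b) := by
    intro a b
    have h1 : R.aug (Pi.single a 1 - p a • w) = 0 := by
      rw [map_sub, map_smul, hw, hpa, sub_eq_zero]
      change _ = Ideal.Quotient.mk I (p a * 1)
      rw [mul_one]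
    obtain ⟨v, hv⟩ := (R.exact_zero _).1 h1
    have h2 := hd v b
    rw [hv, Pi.sub_apply, map_sub, sub_eq_zero, Pi.single_apply, Pi.smul_apply, smul_eq_mul,
      map_mul] at h2
    rw [← h2]
    split_ifs <;> simp
  have hsub : ∀ a b : Fin (R.rank 0), a = b := by
    intro a b
    by_contra hab
    have h1 := hδ a a
    have h2 := hδ b b
    have h3 := hδ a b
    rw [if_pos rfl] at h1 h2
    rw [if_neg (Ne.symm hab)] at h3
    rcases mul_eq_zero.1 h3.symm with h | h
    · rw [h, zero_mul] at h1
      exact one_ne_zero h1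
    · rw [h, mul_zero] at h2
      exact one_ne_zero h2
  obtain ⟨a₀⟩ : Nonempty (Fin (R.rank 0)) := by
    by_contra hempty
    rw [not_nonempty_iff] at hempty
    rw [Subsingleton.elim w 0, map_zero] at hw
    exact hI (Ideal.Quotient.eq_zero_iff_mem.1 hw.symm)
  have hc : constantCoeff (p a₀) ≠ 0 := by
    intro h
    have := hδ a₀ a₀
    rw [h, zero_mul, if_pos rfl] at this
    exact one_ne_zero this
  have hdeg : R.deg 0 a₀ = 0 := by
    by_contra h
    refine hc ?_
    rw [constantCoeff_eq]
    exact (hp a₀).coeff_eq_zero (by simpa using Ne.symm h)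
  have hpC : p a₀ = C (constantCoeff (p a₀)) := by
    have h := hp a₀
    rw [hdeg] at h
    rw [constantCoeff_eq]
    exact totalDegree_eq_zero_iff_eq_C.1 (Nat.le_zero.1 h.totalDegree_le)
  -- The generator maps to the class of a nonzero constant, so the augmentation is the quotient map
  -- up to a unit.
  have haug : ∀ v, R.aug v = 0 ↔ v a₀ ∈ I := by
    intro v
    have hv : v = v a₀ • Pi.single a₀ 1 := by
      funext b
      rw [hsub b a₀]
      simp
    have h1 : R.aug v = Ideal.Quotient.mk I (v a₀ * p a₀) := by
      conv_lhs => rw [hv]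
      rw [map_smul, hpa]
      rfl
    rw [h1, Ideal.Quotient.eq_zero_iff_mem, hpC]
    refine ⟨fun h => ?_, fun h => Ideal.mul_mem_right _ _ h⟩
    have h2 := Ideal.mul_mem_right (C (constantCoeff (p a₀))⁻¹) _ h
    rwa [mul_assoc, ← C_mul, mul_inv_cancel₀ hc, C_1, mul_one] at h2
  have hmul : ∀ v, (fun (_ : Unit) b => R.d 0 (Pi.single b 1) a₀ : Matrix _ _ _) *ᵥ v =
      fun _ => R.d 0 v a₀ := by
    intro v
    funext _
    rw [← LinearMap.toMatrix'_mulVec (R.d 0)]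
    rfl
  refine ⟨{
    idx := fun i => Fin (R.rank (i + 1))
    deg := fun i => R.deg (i + 1)
    aug := fun _ b => R.d 0 (Pi.single b 1) a₀
    d := fun i => LinearMap.toMatrix' (R.d (i + 1))
    aug_homogeneous := ?_
    d_homogeneous := ?_
    mem_iff := ?_
    exact_zero := ?_
    exact_succ := ?_ }, ?_, ?_, ?_⟩
  · intro _ b s hs
    have := R.d_homogeneous 0 b a₀ s hs
    rwa [hdeg] at this
  · intro i a b s hs
    rw [LinearMap.toMatrix'_apply] at hs
    exact R.d_homogeneous (i + 1) b a s hs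
  · intro q
    rw [← haug fun _ => q, R.exact_zero]
    refine exists_congr fun v => ?_
    rw [hmul]
    refine ⟨fun h => congrFun h a₀, fun h => funext fun b => ?_⟩
    rw [hsub b a₀]
    exact h
  · intro v
    have h1 : R.d 0 v = 0 ↔ _ := R.exact_succ 0 v
    simp only [LinearMap.toMatrix'_mulVec]
    rw [hmul]
    refine Iff.trans ⟨fun h => funext fun b => ?_, fun h => ?_⟩ h1
    · rw [hsub b a₀]
      exact congrFun h ()
    · rw [h]
      rfl
  · intro i v
    simp only [LinearMap.toMatrix'_mulVec]
    exact R.exact_succ (i + 1) v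
  · intro i a b
    change constantCoeff (LinearMap.toMatrix' (R.d (i + 1)) a b) = 0
    rw [LinearMap.toMatrix'_apply]
    exact R.minimal (i + 1) b a
  · intro i j
    exact (Fintype.card_subtype _).symm
  · intro j
    have h1 : ∀ a, R.deg 0 a = 0 := fun a => hsub a₀ a ▸ hdeg
    have h2 : Fintype.card (Fin (R.rank 0)) = 1 := Fintype.card_eq_one_iff.2 ⟨a₀, fun b => hsub b a₀⟩
    rw [MinimalGradedFreeResolution.betti]
    simp only [h1]
    by_cases hj : j = 0
    · subst hj
      rw [if_pos rfl, Finset.filter_true_of_mem fun _ _ => rfl, Finset.card_univ, h2]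
    · rw [if_neg hj, Finset.filter_false_of_mem fun _ _ => Ne.symm hj, Finset.card_empty]

/-! ### Edge ideals of the cycle and the wheel -/

theorem two_le_degree_of_mem_edgeIdeal {k V : Type*} [Field k] {G : SimpleGraph V}
    {p : MvPolynomial V k} (hp : p ∈ edgeIdeal k G) (s : V →₀ ℕ) (hs : coeff s p ≠ 0) :
    2 ≤ s.degree := by
  have h : edgeIdeal k G ≤ idealOfVars V k ^ 2 := by
    rw [edgeIdeal, Ideal.span_le]
    rintro _ ⟨u, v, -, rfl⟩
    rw [sq]
    exact Ideal.mul_mem_mul (Ideal.subset_span ⟨u, rfl⟩) (Ideal.subset_span ⟨v, rfl⟩)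
  by_contra hlt
  exact hs ((mem_pow_idealOfVars_iff' 2 p).1 (h hp) s (not_le.1 hlt))

theorem one_notMem_edgeIdeal {k V : Type*} [Field k] (G : SimpleGraph V) :
    (1 : MvPolynomial V k) ∉ edgeIdeal k G := by
  intro h
  have := two_le_degree_of_mem_edgeIdeal h 0 (by simp)
  simp at this

/-- The rim edges generate the first summand and the spokes the second, which is the shape that the
cone construction takes. -/
theorem edgeIdeal_wheelGraph (k : Type*) [Field k] (n : ℕ) :
    edgeIdeal k (wheelGraph n) =
      (edgeIdeal k (SimpleGraph.cycleGraph n)).map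
          (rename some : MvPolynomial (Fin n) k →ₐ[k] MvPolynomial (Option (Fin n)) k) ⊔
        Ideal.span {X none} * Ideal.span (X '' ((Finset.univ.map Function.Embedding.some :
          Finset (Option (Fin n))) : Set (Option (Fin n)))) := by
  apply le_antisymm
  · have h : ∀ v : Fin n, (X none * X (some v) : MvPolynomial (Option (Fin n)) k) ∈
        Ideal.span {X none} * Ideal.span (X '' ((Finset.univ.map Function.Embedding.some :
          Finset (Option (Fin n))) : Set (Option (Fin n)))) := fun v =>
      Ideal.mul_mem_mul (Ideal.mem_span_singleton_self _)
        (Ideal.subset_span ⟨some v, by simp, rfl⟩)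
    rw [edgeIdeal, Ideal.span_le]
    rintro _ ⟨_ | u, _ | v, huv, rfl⟩
    · exact huv.elim
    · exact Ideal.mem_sup_right (h v)
    · rw [mul_comm (X (some u))]
      exact Ideal.mem_sup_right (h u)
    · refine Ideal.mem_sup_left ?_
      have := Ideal.mem_map_of_mem
        (rename some : MvPolynomial (Fin n) k →ₐ[k] MvPolynomial (Option (Fin n)) k)
        (Ideal.subset_span ⟨u, v, huv, rfl⟩ : X u * X v ∈ edgeIdeal k (SimpleGraph.cycleGraph n))
      rwa [map_mul, rename_X, rename_X] at this
  · rw [sup_le_iff]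
    constructor
    · rw [Ideal.map_le_iff_le_comap, edgeIdeal, Ideal.span_le]
      rintro _ ⟨u, v, huv, rfl⟩
      refine Ideal.subset_span ⟨some u, some v, huv, ?_⟩
      rw [map_mul, rename_X, rename_X]
    · rw [Ideal.span_singleton_mul_le_iff]
      intro q hq
      induction hq using Submodule.span_induction with
      | mem x hx =>
        obtain ⟨v, hv, rfl⟩ := hx
        obtain ⟨u, -, rfl⟩ := Finset.mem_map.1 hv
        exact Ideal.subset_span ⟨none, some u, trivial, rfl⟩
      | zero => simp
      | add x y _ _ hx hy => rw [mul_add]; exact Ideal.add_mem _ hx hy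
      | smul c x _ hx =>
        rw [smul_eq_mul, mul_left_comm]
        exact Ideal.mul_mem_left _ _ hx

/-! ### Counting generators of the cone -/

namespace IdealResolution

variable {σ k : Type*} [Field k] {A B : Ideal (MvPolynomial σ k)}

theorem count_eq_ite (F : IdealResolution A) (i m j : ℕ) (h : ∀ a, F.deg i a = m) :
    F.count i j = if j = m then Fintype.card (F.idx i) else 0 := by
  rw [count]
  simp only [h]
  split_ifs with hj
  · subst hj
    exact Fintype.card_congr (Equiv.subtypeUnivEquiv fun _ => rfl)
  · rw [Fintype.card_eq_zero_iff]
    exact ⟨fun a => hj a.2.symm⟩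

theorem card_subtype_sum {α β : Type*} [Fintype α] [Fintype β] (f : α → ℕ) (g : β → ℕ) (j : ℕ) :
    Fintype.card {a : α ⊕ β // Sum.elim f g a = j} =
      Fintype.card {a // f a = j} + Fintype.card {b // g b = j} := by
  rw [Fintype.card_congr (Equiv.subtypeSum (p := fun a => Sum.elim f g a = j)), Fintype.card_sum]
  rfl

theorem card_subtype_add_one {α : Type*} [Fintype α] (f : α → ℕ) (j : ℕ) :
    Fintype.card {a // f a + 1 = j + 1} = Fintype.card {a // f a = j} :=
  Fintype.card_congr (Equiv.subtypeEquivRight fun _ => Nat.succ_inj)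

theorem count_zero_of_cone {C : Ideal (MvPolynomial σ k)} {F : IdealResolution A}
    {K : IdealResolution B} {G : IdealResolution C} (e : ∀ i, G.idx i ≃ ConeIdx F K i)
    (he : ∀ i a, G.deg i a = coneDeg F K i (e i a)) (j : ℕ) :
    G.count 0 (j + 1) = F.count 0 (j + 1) + K.count 0 j := by
  have h1 : G.count 0 (j + 1) = Fintype.card {a // coneDeg F K 0 a = j + 1} :=
    Fintype.card_congr ((e 0).subtypeEquiv fun a => by rw [he])
  have h2 := card_subtype_sum (F.deg 0) (fun b => K.deg 0 b + 1) (j + 1)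
  rw [card_subtype_add_one] at h2
  exact h1.trans h2

theorem count_succ_of_cone {C : Ideal (MvPolynomial σ k)} {F : IdealResolution A}
    {K : IdealResolution B} {G : IdealResolution C} (e : ∀ i, G.idx i ≃ ConeIdx F K i)
    (he : ∀ i a, G.deg i a = coneDeg F K i (e i a)) (i j : ℕ) :
    G.count (i + 1) (j + 1) = F.count (i + 1) (j + 1) + K.count (i + 1) j + F.count i j := by
  have h1 : G.count (i + 1) (j + 1) = Fintype.card {a // coneDeg F K (i + 1) a = j + 1} :=
    Fintype.card_congr ((e (i + 1)).subtypeEquiv fun a => by rw [he])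
  refine h1.trans ((card_subtype_sum (Sum.elim (F.deg (i + 1)) fun b => K.deg (i + 1) b + 1)
    (fun a => F.deg i a + 1) (j + 1)).trans ?_)
  rw [card_subtype_add_one (F.deg i), card_subtype_sum, card_subtype_add_one]
  rfl

end IdealResolution

/-! ### The Betti numbers of the wheel -/

/-- The graded Betti numbers of the wheel graph in terms of those of the cycle. -/
theorem gradedBetti_wheelGraph_succ (k : Type*) [Field k] (n i j : ℕ) (hj : 1 ≤ j) :
    gradedBetti k (wheelGraph n) (i + 1) (j + 1) =
      gradedBetti k (SimpleGraph.cycleGraph n) (i + 1) (j + 1) +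
        gradedBetti k (SimpleGraph.cycleGraph n) i j +
          if j = i + 1 then n.choose (i + 1) else 0 := by
  obtain ⟨F, hF, hFb, hF0⟩ := (exists_minimalGradedFreeResolution_edgeIdeal k
    (SimpleGraph.cycleGraph n)).some.exists_idealResolution (one_notMem_edgeIdeal _)
  obtain ⟨W, hW, hWb, -⟩ := (exists_minimalGradedFreeResolution_edgeIdeal k
    (wheelGraph n)).some.exists_idealResolution (one_notMem_edgeIdeal _)
  obtain ⟨K, hK, hKcard, hKdeg⟩ := IdealResolution.exists_koszul (k := k)
    (Finset.univ.map Function.Embedding.some : Finset (Option (Fin n)))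
  obtain ⟨G, hG, e, he⟩ := F.extend.exists_cone K none
    (by
      rw [Ideal.map_le_iff_le_comap, edgeIdeal, Ideal.span_le]
      rintro _ ⟨u, v, -, rfl⟩
      change rename some (X u * X v : MvPolynomial (Fin n) k) ∈ Ideal.span _
      rw [map_mul, rename_X]
      exact Ideal.mul_mem_right _ _ (Ideal.subset_span ⟨some u, by simp, rfl⟩))
    (IdealResolution.mem_map_rename_some_of_X_none_mul_mem _) hF.extend hK
    (fun i a b => by
      have h1 : i + 2 ≤ F.extend.deg i b :=
        hF.add_two_le_deg (fun p hp => two_le_degree_of_mem_edgeIdeal hp) i b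
      rw [hKdeg]
      omega)
  have hWG : ∀ i j, W.count i j = G.count i j := by
    revert G
    rw [← edgeIdeal_wheelGraph]
    intro G hG _ _
    exact hW.count_eq hG
  have hFx : ∀ i j, F.extend.count i j = F.count i j := fun i j => rfl
  have hcard : (Finset.univ.map Function.Embedding.some : Finset (Option (Fin n))).card = n := by
    simp
  rw [gradedBetti, gradedBetti, hWb, hFb, hWG]
  cases i with
  | zero =>
    -- The cone has no third summand in homological degree `0`; correspondingly `β_{0,j}` of the
    -- cycle vanishes because `1 ≤ j`.
    rw [IdealResolution.count_zero_of_cone e he, hFx, gradedBetti, hF0, if_neg (by omega), add_zero,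
      K.count_eq_ite 0 1 j (hKdeg 0), hKcard, hcard]
  | succ i =>
    rw [IdealResolution.count_succ_of_cone e he, hFx, hFx, gradedBetti, hFb,
      K.count_eq_ite (i + 1) (i + 2) j (hKdeg (i + 1)), hKcard, hcard, add_right_comm]

theorem theorem4 (k : Type*) [Field k] (n : ℕ) (hn : 3 ≤ n) :
    (∀ i j : ℕ, 1 ≤ i → i + 1 < j →
      gradedBetti k (wheelGraph n) i j =
        gradedBetti k (SimpleGraph.cycleGraph n) i j +
          gradedBetti k (SimpleGraph.cycleGraph n) (i - 1) (j - 1)) ∧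
    (∀ j : ℕ, 1 < j →
      gradedBetti k (wheelGraph n) 0 j = gradedBetti k (SimpleGraph.cycleGraph n) 0 j) ∧
    (∀ i : ℕ, 1 ≤ i →
      gradedBetti k (wheelGraph n) i (i + 1) =
        gradedBetti k (SimpleGraph.cycleGraph n) i (i + 1) +
          gradedBetti k (SimpleGraph.cycleGraph n) (i - 1) i + n.choose i) := by
  refine ⟨fun i j hi hj => ?_, fun j hj => ?_, fun i hi => ?_⟩
  · obtain ⟨i, rfl⟩ := Nat.exists_eq_add_of_le' hi
    obtain ⟨j, rfl⟩ := Nat.exists_eq_add_of_le' (show 1 ≤ j by omega)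
    rw [gradedBetti_wheelGraph_succ k n i j (by omega), if_neg (by omega), add_zero,
      Nat.add_sub_cancel, Nat.add_sub_cancel]
  -- For `i = 0` the term with index `i - 1` is zero by convention, and both algebras are cyclic
  -- with generator in degree `0`.
  · obtain ⟨-, -, -, hC⟩ := (exists_minimalGradedFreeResolution_edgeIdeal k
      (SimpleGraph.cycleGraph n)).some.exists_idealResolution (one_notMem_edgeIdeal _)
    obtain ⟨-, -, -, hW⟩ := (exists_minimalGradedFreeResolution_edgeIdeal k
      (wheelGraph n)).some.exists_idealResolution (one_notMem_edgeIdeal _)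
    rw [gradedBetti, gradedBetti, hC, hW]
  · obtain ⟨i, rfl⟩ := Nat.exists_eq_add_of_le' hi
    rw [gradedBetti_wheelGraph_succ k n i (i + 1) (by omega), if_pos rfl, Nat.add_sub_cancel]
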